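/- For $u,t\in\mathbb C$ with $\operatorname{Re}t<\operatorname{Re}u<0$ put $\zeta=e^u$, $q=e^t$ and $$\mathcal{L}i_3=\sum_{n\ge 0}\mathrm{Li}_3(q^n\zeta)+\sum_{n\ge 1}\mathrm{Li}_3(q^n\zeta^{-1})-\chi_3,\qquad \chi_3=\sum_{j=0}^{3}\frac{B_{j+1}}{(3-j)!\,(j+1)!}\,u^{3-j}t^{j},$$ where $\mathrm{Li}_3(w)=\sum_{n\ge1}w^n/n^3$ and $\frac{x}{e^x-1}=\sum_n B_n\frac{x^n}{n!}$; write $\mathcal{L}i_3(1,q)$ for the value of the same expression at $u=0$. For $\tau$ in the upper half plane $\mathbb H$ and $0<\operatorname{Im}z<\operatorname{Im}\tau$ define the elliptic trilogarithm $$f(z,\tau)=\frac{1}{(2\pi i)^3}\bigl\{\mathcal{L}i_3(e^{2\pi i z},q)-\mathcal{L}i_3(1,q)\bigr\},\qquad q=e^{2\pi i\tau}$$ (that is, $u=2\pi i z$, $t=2\pi i\tau$), and extend $f$ by analytic continuation to a multivalued holomorphic function on $\{(z,\tau):\tau\in\mathbb H,\ z\notin\mathbb Z+\mathbb Z\tau\}$.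 Write $f^{(n,m)}=\partial^{n+m}f/\partial z^n\partial\tau^m$. Let $\mathcal R\subset\mathbb R^2$ be the root system of type $A_2$, $B_2$ or $G_2$, with simple roots $\alpha,\beta$ normalized by - $A_2$: $(\alpha,\alpha)=(\beta,\beta)=2$, $(\alpha,\beta)=-1$; - $B_2$: $(\alpha,\alpha)=2$, $(\beta,\beta)=1$, $(\alpha,\beta)=-1$; - $G_2$: $(\alpha,\alpha)=6$, $(\beta,\beta)=2$, $(\alpha,\beta)=-3$, and let $\mathcal R^+$ be the corresponding set of positive roots. Extend $(\cdot,\cdot)$ to a complex bilinear form on $\mathbb C^2$. Then for all $\tau\in\mathbb H$ and all $\mathbf z\in\mathbb C^2$ such that $(\mathbf z,\gamma)\notin\mathbb Z+\mathbb Z\tau$ for every $\gamma\in\mathcal R^+$, the function $f$ has a branch near each point $((\mathbf z,\gamma),\tau)$, $\gamma\in\mathcal R^+$, and, whichever branches are chosen, $$\sum_{\{\gamma,\delta\}\subset\mathcal R^+,\ \gamma\ne\delta}(\gamma,\delta)\,f^{(3,0)}\bigl((\mathbf z,\gamma),\tau\bigr)\,f^{(3,0)}\bigl((\mathbf z,\delta),\tau\bigr)+\sum_{\gamma\in\mathcal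 R^+}k_\gamma\,f^{(2,1)}\bigl((\mathbf z,\gamma),\tau\bigr)=0,$$ where the first sum is over unordered pairs of distinct positive roots (each pair is counted once), and $k_\gamma=1$ for all roots of $A_2$; $k_{\rm short}=2$, $k_{\rm long}=1$ for $B_2$; $k_{\rm short}=10$, $k_{\rm long}=6$ for $G_2$. -/

import Mathlib

noncomputable section

namespace EllipticTrilog

open Complex

/-- The polylogarithm series `Li_r(w) = ∑_{n ≥ 1} w ^ n / n ^ r` (used for `‖w‖ < 1`, and for
`w = 1`, `r = 3`). -/
def polylog (r : ℕ) (w : ℂ) : ℂ :=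
  ∑' n : ℕ, w ^ (n + 1) / ((n : ℂ) + 1) ^ r

/-- The polynomial `χ_r(ζ, q)`, as a function of `u = log ζ` and `t = log q`. The Bernoulli numbers
are those of `x / (e ^ x - 1)`, so `B₁ = -1/2`. -/
def chi (r : ℕ) (u t : ℂ) : ℂ :=
  ∑ j ∈ Finset.range (r + 1),
    ((bernoulli (j + 1) : ℚ) : ℂ) / (((r - j).factorial : ℂ) * ((j + 1).factorial : ℂ)) *
      u ^ (r - j) * t ^ j

/-- The elliptic polylogarithm (`r` odd), as a function of `u = log ζ` and `t = log q`:
`∑_{n ≥ 0} Li_r(q ^ n ζ) + ∑_{n ≥ 1} Li_r(q ^ n ζ⁻¹) - χ_r(ζ, q)`. -/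
def ellipticPolylog (r : ℕ) (u t : ℂ) : ℂ :=
  (∑' n : ℕ, polylog r (exp t ^ n * exp u)) + (∑' n : ℕ, polylog r (exp t ^ (n + 1) * (exp u)⁻¹))
    - chi r u t

/-- The function `f(z, τ) = (2πi)⁻³ (ℒi₃(e^{2πiz}, q) - ℒi₃(1, q))`, `q = e^{2πiτ}`, given by its
defining series; they converge on `strip`. -/
def trilog (p : ℂ × ℂ) : ℂ :=
  1 / (2 * Real.pi * I) ^ 3 *
    (ellipticPolylog 3 (2 * Real.pi * I * p.1) (2 * Real.pi * I * p.2)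
      - ellipticPolylog 3 0 (2 * Real.pi * I * p.2))

/-- The region `0 < Im z < Im τ`, that is `|q| < |ζ| < 1`: here all the arguments `q ^ n ζ` with
`n ≥ 0` and `q ^ n ζ⁻¹` with `n ≥ 1` lie in the open unit disc. -/
def strip : Set (ℂ × ℂ) := {p | 0 < p.1.im ∧ p.1.im < p.2.im}

/-- All `(z, τ)` with `τ` in the upper half plane and `z ∉ ℤ + ℤτ`; on it `f` is a multivalued
holomorphic function. -/
def domain : Set (ℂ × ℂ) := {p | 0 < p.2.im ∧ ∀ m n : ℤ, p.1 ≠ m + n * p.2}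

/-- `IsBranch U g`: the function element `(U, g)` is obtained from `(strip, f)` by analytic
continuation inside `domain`, through a finite chain of holomorphic function elements on
connected open sets, each of which agrees with the preceding one on a nonempty open set. -/
inductive IsBranch : Set (ℂ × ℂ) → (ℂ × ℂ → ℂ) → Prop
  | base : IsBranch strip trilog
  | continuation {U V W : Set (ℂ × ℂ)} {g h : ℂ × ℂ → ℂ} (hg : IsBranch U g)
      (isOpen : IsOpen V) (isPreconnected : IsPreconnected V) (subset : V ⊆ domain)
      (holomorphic : DifferentiableOn ℂ h V)
      (isOpen_overlap : IsOpen W) (nonempty_overlap : W.Nonempty) (overlap : W ⊆ U ∩ V)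
      (eqOn : Set.EqOn g h W) : IsBranch V h

/-- `g` is, near the point `p`, a branch of the multivalued function `f`. -/
def IsBranchAt (g : ℂ × ℂ → ℂ) (p : ℂ × ℂ) : Prop :=
  ∃ U, IsBranch U g ∧ p ∈ U

/-- The partial derivative `∂^{n+m} g / ∂z^n ∂τ^m` at `p = (z, τ)`. -/
def partialDeriv (n m : ℕ) (g : ℂ × ℂ → ℂ) (p : ℂ × ℂ) : ℂ :=
  iteratedDeriv n (fun z => iteratedDeriv m (fun τ => g (z, τ)) p.2) p.1

/-- The pairing `(z, v)` of `z ∈ ℂ²` with a real vector `v`, by the complex bilinear extension of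
the Euclidean inner product. -/
def cpair (z : Fin 2 → ℂ) (v : EuclideanSpace ℝ (Fin 2)) : ℂ :=
  ∑ k, z k * (v k : ℂ)

open Classical in
/-- The identity
`∑_{α ≠ β} (α, β) f^{(3,0)}((z,α),τ) f^{(3,0)}((z,β),τ) + ∑_α k_α f^{(2,1)}((z,α),τ) = 0`,
where `α`, `β` run over the positive roots and the first sum is over unordered pairs (it is written
as half of the sum over ordered pairs). It is claimed for all `z ∈ ℂ²` and `τ` in the upper half
plane such that no `(z, α)` lies in `ℤ + ℤτ`. At these points `f` has a branch, and the
identity holds for every choice of branches of `f`, one at each `((z, α), τ)`. The weight `k_α` is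
given as a function of `(α, α)`. -/
def FrobeniusStickelberger {ι N : Type*} [Fintype ι] [AddCommGroup N] [Module ℝ N]
    {P : RootPairing ι ℝ (EuclideanSpace ℝ (Fin 2)) N} [P.IsCrystallographic] [P.IsReduced]
    (b : P.Base) (k : ℝ → ℂ) : Prop :=
  ∀ (z : Fin 2 → ℂ) (τ : ℂ), 0 < τ.im →
    (∀ i, b.IsPos i → ∀ m n : ℤ, cpair z (P.root i) ≠ m + n * τ) →
    (∀ i, b.IsPos i → ∃ g, IsBranchAt g (cpair z (P.root i), τ)) ∧
    ∀ g : ι → ℂ × ℂ → ℂ, (∀ i, b.IsPos i → IsBranchAt (g i) (cpair z (P.root i), τ)) →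
      (1 / 2 : ℂ) * (∑ i with b.IsPos i, ∑ j with b.IsPos j ∧ j ≠ i,
          ((inner ℝ (P.root i) (P.root j) : ℝ) : ℂ) *
            partialDeriv 3 0 (g i) (cpair z (P.root i), τ) *
            partialDeriv 3 0 (g j) (cpair z (P.root j), τ))
        + ∑ i with b.IsPos i,
            k (inner ℝ (P.root i) (P.root i)) * partialDeriv 2 1 (g i) (cpair z (P.root i), τ)
        = 0

end EllipticTrilog

end

/-!
The derivatives `A = f^{(3,0)}` and `B = f^{(2,1)}` of the multivalued function `f` are
single-valued. On the strip `0 < Im z < Im τ`, differentiating the series of polylogarithms term by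
term (`hasFDerivAt_polyLambert`) turns them into Lambert series in `ζ = e^{2πiz}` and
`q = e^{2πiτ}`,
`A = 1/2 + ζ / (1 - ζ) + ∑_{n ≥ 1} (q^n ζ / (1 - q^n ζ) - q^n ζ⁻¹ / (1 - q^n ζ⁻¹))`,
`B = -1/12 + ∑_{n ≥ 1} n (q^n ζ / (1 - q^n ζ) + q^n ζ⁻¹ / (1 - q^n ζ⁻¹))`,
which converge and are holomorphic on the whole domain (`thetaA`, `thetaB`). The partial derivatives
of a holomorphic function of two variables are holomorphic (`differentiableOn_fderiv_apply`), so by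
the identity theorem (`eqOn_zero_of_eqOn_open`) every branch has these derivatives
(`IsBranch.partialDeriv_eq`).

The heart of the matter is the addition theorem (`thetaA_mul_add_of_add_eq_zero`)
`A(x)A(y) + A(y)A(z) + A(z)A(x) = B(x) + B(y) + B(z)` for `x + y + z = 0`. For the trigonometric
function `a(w) = (1 + w) / (2 (1 - w))` one has `a(u)a(v) + a(v)a(w) + a(w)a(u) = -1/4` when
`uvw = 1`. This is applied to `q^n e^{2πix}`, `q^m e^{2πiy}`, `q^l e^{2πiz}` with `n + m + l = 0`.
Writing each value of `a` as its limit `± 1/2` plus a remainder that decays geometrically and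
summing over the lattice of all `(n, m, l)`, the products of remainders give the left hand side;
the products of a remainder with the signs sum to `∑ n r_n`, the nonconstant part of `B`; and the
products of signs cancel `-1/4` except at the origin (`tsum_mul_add_eq_of_sign_regularized`). No
function theory and no evaluation of constants is needed.

Since `A` is odd and `B` is even, each triple of positive roots `γ + δ = ε` gives a relation
(`thetaA_add`), and the identities for `A₂`, `B₂`, `G₂` are combinations of these relations, with
coefficients read off from the inner products. The positive roots are enumerated from the action of
the simple reflections (`exists_enumeration_isPos`).

For the existence of branches, `Li₃(e^{2πiz})` is continued across the real axis near a non-integral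
point by repeated primitives (`exists_continuation_lam_three`). Below the axis the result agrees
with `f(z + τ, τ)` up to an entire function. Hence `z ↦ z + τ`, as well as the reflection
`z ↦ τ - z`, transports branches to branches (`IsBranch.transport`), which reduces any point of the
domain to one with `0 ≤ Im z < Im τ`.
-/

noncomputable section

namespace EllipticTrilog

open Complex Metric Set Filter Topology MeasureTheory

/-! ### Holomorphic functions of two variables -/

/-- Cauchy's estimate in a complex normed space, in the form in which it dominates series. -/
lemma norm_fderiv_le_of_norm_le {E : Type*} [NormedAddCommGroup E] [NormedSpace ℂ E]
    {f : E → ℂ} {p : E} {r M : ℝ} (hr : 0 < r) (hf : DifferentiableOn ℂ f (ball p r))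
    (hM : ∀ y ∈ ball p r, ‖f y‖ ≤ M) : ‖fderiv ℂ f p‖ ≤ 2 * M / r := by
  refine norm_fderiv_le_div_of_mapsTo_ball hf (fun y hy => ?_) hr
  rw [mem_closedBall, dist_eq_norm]
  calc ‖f y - f p‖ ≤ ‖f y‖ + ‖f p‖ := norm_sub_le _ _
    _ ≤ 2 * M := by linarith [hM y hy, hM p (mem_ball_self hr)]

/-- A dominated series of holomorphic functions on an open subset of a complex normed space can be
differentiated term by term. -/
theorem hasFDerivAt_tsum_of_norm_le {E : Type*} [NormedAddCommGroup E] [NormedSpace ℂ E]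
    {ι : Type*} {f : ι → E → ℂ} {V : Set E} (hV : IsOpen V)
    (hf : ∀ n, DifferentiableOn ℂ (f n) V) {u : ι → ℝ} (hu : Summable u)
    (hb : ∀ n, ∀ p ∈ V, ‖f n p‖ ≤ u n) {p : E} (hp : p ∈ V) :
    Summable (fun n => fderiv ℂ (f n) p) ∧
      HasFDerivAt (fun y => ∑' n, f n y) (∑' n, fderiv ℂ (f n) p) p := by
  obtain ⟨r, hr, hrV⟩ := Metric.isOpen_iff.1 hV p hp
  have hsub : ∀ y ∈ ball p (r / 2), ball y (r / 2) ⊆ V := fun y hy =>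
    (ball_subset_ball' (by rw [mem_ball] at hy; linarith)).trans hrV
  have hbd : ∀ n, ∀ y ∈ ball p (r / 2), ‖fderiv ℂ (f n) y‖ ≤ 2 * u n / (r / 2) := fun n y hy =>
    norm_fderiv_le_of_norm_le (by positivity) ((hf n).mono (hsub y hy))
      fun x hx => hb n x (hsub y hy hx)
  have hu' : Summable fun n => 2 * u n / (r / 2) := (hu.mul_left 2).div_const _
  have hpb : p ∈ ball p (r / 2) := mem_ball_self (by positivity)
  refine ⟨.of_norm_bounded hu' fun n => hbd n p hpb, ?_⟩
  let _ : NormedSpace ℝ E := NormedSpace.restrictScalars ℝ ℂ E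
  refine hasFDerivAt_tsum_of_isPreconnected hu' isOpen_ball
    (convex_ball p (r / 2)).isPreconnected (fun n y hy => ?_) hbd hpb
    (.of_norm_bounded hu fun n => hb n p hp) hpb
  exact ((hf n).differentiableAt (hV.mem_nhds (hsub y hy (mem_ball_self (by positivity))))
    ).hasFDerivAt

/-- A directional derivative of a holomorphic function on an open subset of `ℂ²` is holomorphic:
it is a Cauchy integral depending holomorphically on a parameter. -/
theorem differentiableOn_fderiv_apply {φ : ℂ × ℂ → ℂ} {V : Set (ℂ × ℂ)} (hV : IsOpen V)
    (hφ : DifferentiableOn ℂ φ V) (v : ℂ × ℂ) :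
    DifferentiableOn ℂ (fun p => fderiv ℂ φ p v) V := by
  intro p hp
  refine DifferentiableAt.differentiableWithinAt ?_
  obtain ⟨R, hR, hRV⟩ := Metric.nhds_basis_closedBall.mem_iff.1 (hV.mem_nhds hp)
  obtain ⟨M, hM⟩ := ((isCompact_closedBall p R).image_of_continuousOn
    (hφ.continuousOn.mono hRV)).isBounded.exists_norm_le
  -- For `y` within `R / 3` of `p` and `|w| ≤ r`, the ball of radius `R / 3` around `y + w v` lies in
  -- the ball of radius `R` around `p`; this leaves room for Cauchy's estimate on the circle `|w| = r`.
  set r : ℝ := R / (3 * (‖v‖ + 1)) with hrdef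
  have hv := norm_nonneg v
  have hr : 0 < r := by positivity
  have hrv : r * ‖v‖ < R / 3 := by
    rw [hrdef, div_mul_eq_mul_div, div_lt_div_iff₀ (by positivity) (by positivity)]
    nlinarith
  have hin : ∀ y ∈ ball p (R / 3), ∀ w : ℂ, ‖w‖ ≤ r → ball (y + w • v) (R / 3) ⊆ ball p R := by
    intro y hy w hw
    refine ball_subset_ball' ?_
    have h1 : dist (y + w • v) y ≤ r * ‖v‖ := by
      rw [dist_eq_norm, add_sub_cancel_left, norm_smul]; gcongr
    have h2 := dist_triangle (y + w • v) y p
    rw [mem_ball] at hy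
    linarith
  have hR3 : 0 < R / 3 := by positivity
  have hVn : ∀ y ∈ ball p R, V ∈ 𝓝 y := fun y hy => hV.mem_nhds (hRV (ball_subset_closedBall hy))
  have hd : ∀ y ∈ ball p R, DifferentiableAt ℂ φ y := fun y hy => hφ.differentiableAt (hVn y hy)
  have hin' : ∀ y ∈ ball p (R / 3), ∀ w : ℂ, ‖w‖ ≤ r → y + w • v ∈ ball p R := fun y hy w hw =>
    hin y hy w hw (mem_ball_self hR3)
  -- Cauchy's formula for the derivative of `w ↦ φ (y + w v)` at `0`.
  have key : ∀ y ∈ ball p (R / 3), fderiv ℂ φ y v =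
      (2 * Real.pi * I : ℂ)⁻¹ • ∮ w in C(0, r), ((w - 0) ^ 2)⁻¹ • φ (y + w • v) := by
    intro y hy
    have hpre : IsOpen ((fun w : ℂ => y + w • v) ⁻¹' V) := hV.preimage (by fun_prop)
    have hD : DifferentiableOn ℂ (fun w : ℂ => φ (y + w • v)) ((fun w : ℂ => y + w • v) ⁻¹' V) :=
      hφ.comp (by fun_prop) fun w hw => hw
    have h1 := two_pi_I_inv_smul_circleIntegral_sub_sq_inv_smul_of_differentiable hpre
      (c := 0) (R := r) (fun w hw => hRV (ball_subset_closedBall (hin' y hy w (by simpa using hw))))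
      hD (mem_ball_self hr)
    rw [h1]
    have h2 : HasDerivAt (fun w : ℂ => y + w • v) v 0 := by
      simpa using ((hasDerivAt_id (0 : ℂ)).smul_const v).const_add y
    have h3 : HasFDerivAt φ (fderiv ℂ φ y) ((fun w : ℂ => y + w • v) 0) := by
      simpa using (hd y (by simpa using hin' y hy 0 (by simpa using hr.le))).hasFDerivAt
    exact (h3.comp_hasDerivAt 0 h2).deriv.symm
  have hev : (fun p => fderiv ℂ φ p v) =ᶠ[𝓝 p] fun y =>
      (2 * Real.pi * I : ℂ)⁻¹ • ∮ w in C(0, r), ((w - 0) ^ 2)⁻¹ • φ (y + w • v) :=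
    Filter.eventually_of_mem (ball_mem_nhds p hR3) key
  refine (DifferentiableAt.fun_const_smul ?_ _).congr_of_eventuallyEq hev
  simp only [circleIntegral, sub_zero]
  have hcn : ∀ θ : ℝ, ‖circleMap 0 r θ‖ = r := fun θ => by simp [hr.le]
  set k : ℝ → ℂ := fun θ => deriv (circleMap 0 r) θ * (circleMap 0 r θ ^ 2)⁻¹ with hk
  have hkc : Continuous k := by
    simp only [hk, deriv_circleMap]
    refine .mul (by fun_prop) (.inv₀ (by fun_prop) fun θ => ?_)
    exact pow_ne_zero _ (by rw [← norm_pos_iff, hcn]; exact hr)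
  have hcont : ∀ y ∈ ball p (R / 3), Continuous fun θ : ℝ => k θ * φ (y + circleMap 0 r θ • v) := by
    intro y hy
    refine hkc.mul (continuous_iff_continuousAt.2 fun θ => ?_)
    exact ContinuousAt.comp (f := fun θ : ℝ => y + circleMap 0 r θ • v)
      (hd _ (hin' y hy _ (hcn θ).le)).continuousAt (by fun_prop)
  have hpb : p ∈ ball p (R / 3) := mem_ball_self hR3
  have : ProperSpace (ℂ × ℂ →L[ℂ] ℂ) := FiniteDimensional.proper ℂ _
  have hmeas : Measurable fun θ : ℝ => k θ • fderiv ℂ φ (p + circleMap 0 r θ • v) := by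
    refine hkc.measurable.smul ((measurable_fderiv ℂ φ).comp ?_)
    exact Continuous.measurable (by fun_prop)
  have hbound : ∀ θ : ℝ, ∀ y ∈ ball p (R / 3),
      ‖k θ • fderiv ℂ φ (y + circleMap 0 r θ • v)‖ ≤ ‖k θ‖ * (2 * M / (R / 3)) := by
    intro θ y hy
    rw [norm_smul]
    gcongr
    have hs := hin y hy _ (hcn θ).le
    exact norm_fderiv_le_of_norm_le hR3
      (fun x hx => (hd x (hs hx)).differentiableWithinAt)
      fun x hx => hM _ ⟨x, ball_subset_closedBall (hs hx), rfl⟩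
  have := hasFDerivAt_integral_of_dominated_of_fderiv_le (𝕜 := ℂ)
    (μ := volume.restrict (Ioc 0 (2 * Real.pi)))
    (F := fun y θ => k θ * φ (y + circleMap 0 r θ • v))
    (F' := fun y θ => k θ • fderiv ℂ φ (y + circleMap 0 r θ • v))
    (bound := fun θ => ‖k θ‖ * (2 * M / (R / 3)))
    (ball_mem_nhds p hR3)
    (Filter.eventually_of_mem (ball_mem_nhds p hR3) fun y hy =>
      (hcont y hy).aestronglyMeasurable)
    ((hcont p hpb).integrableOn_Ioc) hmeas.aestronglyMeasurable
    (Eventually.of_forall hbound)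
    ((hkc.norm.mul_const _).integrableOn_Ioc)
    (Eventually.of_forall fun θ y hy => by
      have h := (hd _ (hin' y hy _ (hcn θ).le)).hasFDerivAt
      have h2 : HasFDerivAt (fun y : ℂ × ℂ => y + circleMap 0 r θ • v)
        (ContinuousLinearMap.id ℂ (ℂ × ℂ)) y := (hasFDerivAt_id y).add_const _
      simpa using (h.comp y h2).const_mul (k θ))
  refine this.differentiableAt.congr_of_eventuallyEq (Eventually.of_forall fun y => ?_)
  simp only [intervalIntegral.integral_of_le (show (0 : ℝ) ≤ 2 * Real.pi by positivity)]
  simp [hk, mul_assoc]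

/-- The identity theorem for holomorphic functions on a connected open subset of `ℂ²`. -/
theorem eqOn_zero_of_eqOn_open {φ : ℂ × ℂ → ℂ} {V W : Set (ℂ × ℂ)} (hV : IsOpen V)
    (hVc : IsPreconnected V) (hφ : DifferentiableOn ℂ φ V) (hW : IsOpen W) (hWV : W ⊆ V)
    (hWn : W.Nonempty) (h0 : ∀ p ∈ W, φ p = 0) : ∀ p ∈ V, φ p = 0 := by
  -- The set of points near which `φ` vanishes is open, and closed in `V`.
  suffices V ⊆ {p | ∀ᶠ y in 𝓝 p, φ y = 0} from fun p hp => (this hp).self_of_nhds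
  obtain ⟨q, hq⟩ := hWn
  refine hVc.subset_of_closure_inter_subset isOpen_setOfPred_eventually_nhds
    ⟨q, hWV hq, Filter.eventually_of_mem (hW.mem_nhds hq) h0⟩ ?_
  rintro p ⟨hpc, hpV⟩
  obtain ⟨r, hr, hrV⟩ := Metric.isOpen_iff.1 hV p hpV
  obtain ⟨y, hy, hyr⟩ := Metric.mem_closure_iff.1 hpc r hr
  rw [dist_comm] at hyr
  refine Filter.eventually_of_mem (ball_mem_nhds p hr) ?_
  have hprod : ball p r = ball p.1 r ×ˢ ball p.2 r := (ball_prod_same p.1 p.2 r).symm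
  have hyb : y ∈ ball p.1 r ×ˢ ball p.2 r := hprod ▸ hyr
  have hconn : ∀ a : ℂ, IsPreconnected (ball a r) := fun a => (convex_ball a r).isPreconnected
  have hz : ∀ τ ∈ ball p.2 r, DifferentiableOn ℂ (fun z => φ (z, τ)) (ball p.1 r) := fun τ hτ =>
    hφ.comp (by fun_prop) fun z hz => hrV (hprod ▸ mk_mem_prod hz hτ)
  have ht : ∀ z ∈ ball p.1 r, DifferentiableOn ℂ (fun τ => φ (z, τ)) (ball p.2 r) := fun z hz =>
    hφ.comp (by fun_prop) fun τ hτ => hrV (hprod ▸ mk_mem_prod hz hτ)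
  have hy2 : ∀ᶠ τ in 𝓝 y.2, ∀ᶠ z in 𝓝 y.1, φ (z, τ) = 0 := by
    have : ∀ᶠ x in 𝓝 y.1 ×ˢ 𝓝 y.2, φ x = 0 := by rw [← nhds_prod_eq]; exact hy
    exact (Filter.Eventually.curry (Filter.eventually_swap_iff.1 this))
  -- The zeros spread first along the lines `τ = const`, then along the lines `z = const`.
  have step : ∀ z ∈ ball p.1 r, ∀ᶠ τ in 𝓝 y.2, φ (z, τ) = 0 := by
    intro z hzb
    filter_upwards [hy2, isOpen_ball.mem_nhds hyb.2] with τ h1 h2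
    exact ((hz τ h2).analyticOnNhd isOpen_ball).eqOn_zero_of_preconnected_of_eventuallyEq_zero
      (hconn _) hyb.1 h1 hzb
  rintro ⟨z, τ⟩ hx
  rw [hprod] at hx
  exact ((ht z hx.1).analyticOnNhd isOpen_ball).eqOn_zero_of_preconnected_of_eventuallyEq_zero
      (hconn _) hyb.2 (step z hx.1) hx.2

/-! ### A bilinear summation identity over the hexagonal lattice -/

/-- The difference of two translates of the sign function on `ℤ`. -/
lemma hasSum_sign_add_sub_sign (n : ℤ) :
    HasSum (fun m : ℤ => (((n + m).sign : ℤ) : ℝ) - ((m.sign : ℤ) : ℝ)) (2 * n) := by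
  have h1 : HasSum (fun m : ℤ => (((1 + m).sign : ℤ) : ℝ) - ((m.sign : ℤ) : ℝ)) 2 := by
    have : HasSum (fun m : ℤ => (((1 + m).sign : ℤ) : ℝ) - ((m.sign : ℤ) : ℝ)) _ :=
      hasSum_sum_of_ne_finset_zero (s := {-1, 0}) fun m hm => by
        simp only [Finset.mem_insert, Finset.mem_singleton, not_or] at hm
        rcases lt_or_gt_of_ne hm.2 with h | h
        · rw [Int.sign_eq_neg_one_of_neg h, Int.sign_eq_neg_one_of_neg (by omega)]; simp
        · rw [Int.sign_eq_one_of_pos h, Int.sign_eq_one_of_pos (by omega)]; simp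
    convert! this using 1
    norm_num
  have hnat : ∀ k : ℕ, HasSum
      (fun m : ℤ => ((((k : ℤ) + m).sign : ℤ) : ℝ) - ((m.sign : ℤ) : ℝ)) (2 * (k : ℝ)) := by
    intro k
    induction k with
    | zero => simp
    | succ k ih =>
      convert! ((Equiv.addLeft (k : ℤ)).hasSum_iff.2 h1).add ih using 1
      · ext m
        simp only [Function.comp_apply, Equiv.coe_addLeft]
        push_cast
        rw [← add_assoc, add_comm 1 (k : ℤ)]
        ring
      · push_cast; ring
  obtain ⟨k, rfl | rfl⟩ := n.eq_nat_or_neg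
  · simpa using hnat k
  · convert! ((Equiv.addLeft (-(k : ℤ))).hasSum_iff.2 (hnat k)).neg using 1
    · ext m
      simp
    · push_cast; ring

/-- `∑_m |sgn (n + m) - sgn m| = 2 |n|`: all the terms have the sign of `n`. -/
lemma hasSum_abs_sign_add_sub_sign (n : ℤ) :
    HasSum (fun m : ℤ => |(((n + m).sign : ℤ) : ℝ) - ((m.sign : ℤ) : ℝ)|) (2 * |(n : ℝ)|) := by
  have hmono : ∀ a b : ℤ, a ≤ b → ((a.sign : ℤ) : ℝ) ≤ ((b.sign : ℤ) : ℝ) := fun a b h => by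
    norm_cast
    rcases lt_trichotomy a 0 with ha | rfl | ha <;> rcases lt_trichotomy b 0 with hb | rfl | hb <;>
      simp_all [Int.sign_eq_neg_one_of_neg, Int.sign_eq_one_of_pos] <;> omega
  rcases le_total 0 n with h | h
  · have h' : (0 : ℝ) ≤ n := by exact_mod_cast h
    rw [abs_of_nonneg h']
    convert! hasSum_sign_add_sub_sign n using 2 with m
    exact abs_of_nonneg (sub_nonneg.2 (hmono _ _ (by omega)))
  · have h' : (n : ℝ) ≤ 0 := by exact_mod_cast h
    rw [abs_of_nonpos h', mul_neg]
    convert! (hasSum_sign_add_sub_sign n).neg using 2 with m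
    exact abs_of_nonpos (sub_nonpos.2 (hmono _ _ (by omega)))

/-- At each point of the lattice `n + m + l = 0` other than the origin, the three products of signs
add up to `-1`. -/
lemma sign_mul_add_sign_mul_add_sign_mul (n m : ℤ) :
    n.sign * m.sign + m.sign * (-n - m).sign + (-n - m).sign * n.sign =
      if (n, m) = (0, 0) then 0 else -1 := by
  rcases lt_trichotomy n 0 with hn | hn | hn <;> rcases lt_trichotomy m 0 with hm | hm | hm <;>
    rcases lt_trichotomy (-n - m) 0 with hl | hl | hl <;>
    simp_all [Int.sign_eq_neg_one_of_neg, Int.sign_eq_one_of_pos, ne_of_lt, ne_of_gt] <;> omega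

/-- The rotation `(n, m) ↦ (m, l)` of the lattice `n + m + l = 0`. -/
def rotate : ℤ × ℤ ≃ ℤ × ℤ where
  toFun p := (p.2, -p.1 - p.2)
  invFun p := (-p.1 - p.2, p.1)
  left_inv p := by ext <;> simp; ring
  right_inv p := by ext <;> simp

/-- Summation by parts over the lattice `n + m + l = 0`: the weight `sgn m + sgn l`, summed over
all `m`, gives `-2 n`. -/
lemma hasSum_mul_sign_add_sign {r : ℤ → ℂ} (hr : Summable fun n : ℤ => ‖(n : ℂ) * r n‖) :
    HasSum (fun p : ℤ × ℤ => r p.1 * ((p.2.sign : ℤ) + ((-p.1 - p.2).sign : ℤ)))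
      (-2 * ∑' n : ℤ, (n : ℂ) * r n) := by
  have hs : ∀ n m : ℤ, ((m.sign : ℤ) + ((-n - m).sign : ℤ) : ℂ) =
      -(((((n + m).sign : ℤ) : ℝ) - ((m.sign : ℤ) : ℝ) : ℝ) : ℂ) := fun n m => by
    rw [show -n - m = -(n + m) by ring, Int.sign_neg]; push_cast; ring
  have hinner : ∀ n : ℤ, HasSum (fun m : ℤ => r n * ((m.sign : ℤ) + ((-n - m).sign : ℤ)))
      (-2 * ((n : ℂ) * r n)) := fun n => by
    have h := ((Complex.hasSum_ofReal.2 (hasSum_sign_add_sub_sign n)).neg.mul_left (r n))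
    convert! h using 1
    · ext m; rw [hs]
    · push_cast; ring
  have hsum : Summable fun p : ℤ × ℤ =>
      r p.1 * ((p.2.sign : ℤ) + ((-p.1 - p.2).sign : ℤ)) := by
    refine Summable.of_norm ?_
    have hn : ∀ n : ℤ, HasSum
        (fun m : ℤ => ‖r n * ((m.sign : ℤ) + ((-n - m).sign : ℤ))‖) (‖r n‖ * (2 * |(n : ℝ)|)) :=
      fun n => by
        convert! (hasSum_abs_sign_add_sub_sign n).mul_left ‖r n‖ using 2 with m
        rw [hs, norm_mul, norm_neg, Complex.norm_real, Real.norm_eq_abs]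
    refine (summable_prod_of_nonneg fun p => norm_nonneg _).2 ⟨fun n => (hn n).summable, ?_⟩
    simp only [(hn _).tsum_eq]
    refine (hr.mul_left 2).congr fun n => ?_
    rw [norm_mul, Complex.norm_intCast]; ring
  have hN : HasSum (fun n : ℤ => -2 * ((n : ℂ) * r n)) (-2 * ∑' n : ℤ, (n : ℂ) * r n) :=
    hr.of_norm.hasSum.mul_left _
  exact (hsum.hasSum.prod_fiberwise hinner).unique hN ▸ hsum.hasSum

/-- If `a_n b_m + b_m c_l + c_l a_n = -1/4` whenever `n + m + l = 0`, then the regularized sums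
`A = ∑ (a_n - sgn n / 2)` etc. satisfy `A B + B C + C A = A' + B' + C' - 1/4`, with the weighted
sums `A' = ∑ n (a_n - sgn n / 2)` etc. -/
theorem tsum_mul_add_eq_of_sign_regularized {a b c : ℤ → ℂ}
    (habc : ∀ n m, a n * b m + b m * c (-n - m) + c (-n - m) * a n = -1 / 4)
    (ha : Summable fun n : ℤ => ‖a n - (n.sign : ℤ) / 2‖)
    (hb : Summable fun n : ℤ => ‖b n - (n.sign : ℤ) / 2‖)
    (hc : Summable fun n : ℤ => ‖c n - (n.sign : ℤ) / 2‖)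
    (ha' : Summable fun n : ℤ => ‖(n : ℂ) * (a n - (n.sign : ℤ) / 2)‖)
    (hb' : Summable fun n : ℤ => ‖(n : ℂ) * (b n - (n.sign : ℤ) / 2)‖)
    (hc' : Summable fun n : ℤ => ‖(n : ℂ) * (c n - (n.sign : ℤ) / 2)‖) :
    (∑' n : ℤ, (a n - (n.sign : ℤ) / 2)) * (∑' n : ℤ, (b n - (n.sign : ℤ) / 2)) +
      (∑' n : ℤ, (b n - (n.sign : ℤ) / 2)) * (∑' n : ℤ, (c n - (n.sign : ℤ) / 2)) +
      (∑' n : ℤ, (c n - (n.sign : ℤ) / 2)) * (∑' n : ℤ, (a n - (n.sign : ℤ) / 2)) =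
    (∑' n : ℤ, (n : ℂ) * (a n - (n.sign : ℤ) / 2)) +
      (∑' n : ℤ, (n : ℂ) * (b n - (n.sign : ℤ) / 2)) +
      (∑' n : ℤ, (n : ℂ) * (c n - (n.sign : ℤ) / 2)) - 1 / 4 := by
  have hmul : ∀ {u v : ℤ → ℂ}, Summable (fun n => ‖u n‖) → Summable (fun n => ‖v n‖) →
      HasSum (fun p : ℤ × ℤ => u p.1 * v p.2) ((∑' n, u n) * ∑' n, v n) := fun hu hv =>
    hu.of_norm.hasSum.mul hv.of_norm.hasSum (summable_mul_of_summable_norm hu hv)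
  have h1 := hmul ha hb
  have h2 := rotate.hasSum_iff.2 (hmul hb hc)
  have h3 := (rotate.trans rotate).hasSum_iff.2 (hmul hc ha)
  have k1 := hasSum_mul_sign_add_sign ha'
  have k2 := rotate.hasSum_iff.2 (hasSum_mul_sign_add_sign hb')
  have k3 := (rotate.trans rotate).hasSum_iff.2 (hasSum_mul_sign_add_sign hc')
  have htot := ((h1.add h2).add h3).add (((k1.add k2).add k3).mul_left (1 / 2))
  have hdelta : HasSum (fun p : ℤ × ℤ => if p = (0, 0) then (-1 / 4 : ℂ) else 0) (-1 / 4) :=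
    hasSum_ite_eq _ _
  have := htot.unique (hdelta.congr_fun ?_)
  · linear_combination this
  · rintro ⟨n, m⟩
    have hsig := congrArg (Int.cast : ℤ → ℂ) (sign_mul_add_sign_mul_add_sign_mul n m)
    have h0 := habc n m
    have e1 : -m - (-n - m) = n := by ring
    have e2 : -(-n - m) - n = m := by ring
    simp only [Function.comp_apply, Equiv.trans_apply, rotate, Equiv.coe_fn_mk, e1, e2]
    push_cast at hsig
    split_ifs at hsig ⊢ with h
    all_goals linear_combination h0 - hsig / 4

/-! ### Lambert series -/

/-- The exponential `e^{2πix}`. -/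
def cexp2 (x : ℂ) : ℂ := exp (2 * Real.pi * I * x)

lemma cexp2_add (x y : ℂ) : cexp2 (x + y) = cexp2 x * cexp2 y := by
  simp [cexp2, mul_add, exp_add]

lemma cexp2_neg (x : ℂ) : cexp2 (-x) = (cexp2 x)⁻¹ := by
  simp [cexp2, exp_neg]

lemma cexp2_ne_zero (x : ℂ) : cexp2 x ≠ 0 := exp_ne_zero _

lemma cexp2_eq_one_iff {x : ℂ} : cexp2 x = 1 ↔ ∃ n : ℤ, x = n := by
  rw [cexp2, exp_eq_one_iff]
  refine exists_congr fun n => ?_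
  rw [mul_comm (n : ℂ)]
  exact mul_right_inj' two_pi_I_ne_zero

lemma norm_cexp2 (x : ℂ) : ‖cexp2 x‖ = Real.exp (-(2 * Real.pi * x.im)) := by
  rw [cexp2, norm_exp]
  congr 1
  simp [mul_re]

lemma hasDerivAt_cexp2 (x : ℂ) : HasDerivAt cexp2 (2 * Real.pi * I * cexp2 x) x := by
  have h : HasDerivAt (fun y : ℂ => 2 * Real.pi * I * y) (2 * Real.pi * I) x := by
    simpa using (hasDerivAt_id x).const_mul (2 * Real.pi * I : ℂ)
  have h2 := h.cexp
  rw [mul_comm (exp _)] at h2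
  exact h2

lemma differentiable_cexp2 : Differentiable ℂ cexp2 := fun x =>
  (hasDerivAt_cexp2 x).differentiableAt

lemma cexp2_add_mul_ne_one {z τ : ℂ} (h : ∀ m n : ℤ, z ≠ m + n * τ) (n : ℤ) :
    cexp2 (z + n * τ) ≠ 1 := fun h1 => by
  obtain ⟨m, hm⟩ := cexp2_eq_one_iff.1 h1
  exact h m (-n) (by push_cast; linear_combination hm)

/-- The sum of the geometric series `∑_{m ≥ 1} e^{2πimx}`, as a rational function of
`e^{2πix}`. -/
def geom (x : ℂ) : ℂ := cexp2 x / (1 - cexp2 x)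

lemma differentiableAt_geom {x : ℂ} (hx : cexp2 x ≠ 1) : DifferentiableAt ℂ geom x :=
  (differentiable_cexp2 x).div ((differentiable_cexp2 x).const_sub 1) (sub_ne_zero.2 hx.symm)

/-- The Lambert series `∑_{n ≥ 1} n ^ k q ^ n ζ / (1 - q ^ n ζ)`, with `ζ = e^{2πix}` and
`q = e^{2πiτ}`. -/
def lambert (k : ℕ) (x τ : ℂ) : ℂ := ∑' n : ℕ, ((n : ℂ) + 1) ^ k * geom (x + (n + 1) * τ)

/-- The single-valued function `f^{(3,0)}`; it is `-1/(2πi)` times the logarithmic derivative in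
`z` of the odd theta function, and changes by a constant under `z ↦ z + τ`. -/
def thetaA (p : ℂ × ℂ) : ℂ := 1 / 2 + geom p.1 + lambert 0 p.1 p.2 - lambert 0 (-p.1) p.2

/-- The single-valued function `f^{(2,1)}`. -/
def thetaB (p : ℂ × ℂ) : ℂ := -1 / 12 + lambert 1 p.1 p.2 + lambert 1 (-p.1) p.2

lemma summable_nat_add_one_pow_mul_geometric (k : ℕ) {ρ : ℝ} (h0 : 0 ≤ ρ) (h1 : ρ < 1) :
    Summable fun n : ℕ => ((n : ℝ) + 1) ^ k * ρ ^ n := by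
  rcases h0.eq_or_lt with rfl | h0
  · exact summable_of_ne_finset_zero (s := {0}) fun n hn => by
      simp [zero_pow (show n ≠ 0 by simpa using hn)]
  have h := (summable_nat_add_iff 1).2
    (summable_pow_mul_geometric_of_norm_lt_one (R := ℝ) k (r := ρ)
      (by rwa [Real.norm_of_nonneg h0.le]))
  refine (h.mul_left ρ⁻¹).congr fun n => ?_
  push_cast
  rw [pow_succ]
  field_simp

lemma norm_cexp2_add_mul_le {a b : ℝ} {x τ : ℂ} (hx : -a ≤ x.im) (hτ : b ≤ τ.im) (n : ℕ) :
    ‖cexp2 (x + n * τ)‖ ≤ Real.exp (2 * Real.pi * a) * Real.exp (-(2 * Real.pi * b)) ^ n := by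
  rw [norm_cexp2, ← Real.exp_nat_mul, ← Real.exp_add, Real.exp_le_exp]
  simp only [add_im, mul_im, natCast_re, natCast_im, zero_mul, add_zero]
  have h1 : (n : ℝ) * b ≤ n * τ.im := by gcongr
  have h2 : 2 * Real.pi * (-a + n * b) ≤ 2 * Real.pi * (x.im + n * τ.im) := by
    gcongr
  linarith

/-- The terms of a Lambert series decay geometrically, uniformly on `Im x ≥ -a`, `Im τ ≥ b`. -/
lemma exists_norm_geom_le (a : ℝ) {b : ℝ} (hb : 0 < b) :
    ∃ (C ρ : ℝ) (N : ℕ), 0 ≤ ρ ∧ ρ < 1 ∧ ∀ n ≥ N, ∀ x τ : ℂ, -a ≤ x.im → b ≤ τ.im →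
      cexp2 (x + (n + 1) * τ) ≠ 1 ∧ ‖geom (x + (n + 1) * τ)‖ ≤ C * ρ ^ n := by
  set ρ := Real.exp (-(2 * Real.pi * b)) with hρ
  have hρ0 : 0 < ρ := Real.exp_pos _
  have hρ1 : ρ < 1 := by
    rw [hρ, ← Real.exp_zero, Real.exp_lt_exp]
    exact neg_lt_zero.2 (by positivity)
  set K := Real.exp (2 * Real.pi * a)
  have hK : 0 < K := Real.exp_pos _
  have hlim : Tendsto (fun n : ℕ => K * ρ ^ (n + 1)) atTop (𝓝 (K * 0)) :=
    ((tendsto_pow_atTop_nhds_zero_of_lt_one hρ0.le hρ1).comp (tendsto_add_atTop_nat 1)).const_mul K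
  rw [mul_zero] at hlim
  -- Beyond `N` the exponentials are at most `1 / 2`, and then `|w / (1 - w)| ≤ 2 |w|`.
  obtain ⟨N, hN⟩ := eventually_atTop.1
    (hlim.eventually (gt_mem_nhds (show (0 : ℝ) < 1 / 2 by norm_num)))
  refine ⟨2 * K * ρ, ρ, N, hρ0.le, hρ1, fun n hn x τ hx hτ => ?_⟩
  have h1 := norm_cexp2_add_mul_le hx hτ (n + 1)
  have h2 := hN n hn
  push_cast at h1
  set w := cexp2 (x + (n + 1) * τ) with hw
  have h3 : ‖w‖ ≤ 1 / 2 := h1.trans h2.le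
  have h4 : 1 / 2 ≤ ‖1 - w‖ := by
    have := norm_sub_norm_le (1 : ℂ) w
    rw [norm_one] at this; linarith
  refine ⟨fun h => by rw [h, sub_self, norm_zero] at h4; linarith, ?_⟩
  rw [geom, ← hw, norm_div, div_le_iff₀ (by linarith)]
  calc ‖w‖ ≤ K * ρ ^ (n + 1) := h1
    _ = 2 * K * ρ * ρ ^ n * (1 / 2) := by ring
    _ ≤ _ := by gcongr

lemma summable_norm_lambert (k : ℕ) (x : ℂ) {τ : ℂ} (hτ : 0 < τ.im) :
    Summable fun n : ℕ => ‖((n : ℂ) + 1) ^ k * geom (x + (n + 1) * τ)‖ := by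
  obtain ⟨C, ρ, N, h0, h1, h⟩ := exists_norm_geom_le (-x.im) hτ
  refine Summable.of_norm_bounded_eventually_nat
    ((summable_nat_add_one_pow_mul_geometric k h0 h1).mul_left C) ?_
  filter_upwards [eventually_ge_atTop N] with n hn
  rw [norm_norm, norm_mul, norm_pow]
  have h2 : ‖(n : ℂ) + 1‖ = (n : ℝ) + 1 := by exact_mod_cast Complex.norm_natCast (n + 1)
  calc _ ≤ ((n : ℝ) + 1) ^ k * (C * ρ ^ n) := by
        rw [h2]; gcongr; exact (h n hn x τ (by simp) le_rfl).2
    _ = _ := by ring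

lemma differentiableAt_lambert (k : ℕ) {p : ℂ × ℂ} (hτ : 0 < p.2.im)
    (hp : ∀ n : ℕ, cexp2 (p.1 + (n + 1) * p.2) ≠ 1) :
    DifferentiableAt ℂ (fun p : ℂ × ℂ => lambert k p.1 p.2) p := by
  obtain ⟨C, ρ, N, h0, h1, h⟩ := exists_norm_geom_le (|p.1.im| + 1) (half_pos hτ)
  set V : Set (ℂ × ℂ) := {y | -(|p.1.im| + 1) < y.1.im ∧ p.2.im / 2 < y.2.im} with hVdef
  have hV : IsOpen V := by
    rw [hVdef]; simp only [ofPred_and]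
    exact (isOpen_lt continuous_const (by fun_prop)).inter
      (isOpen_lt continuous_const (by fun_prop))
  have hpV : p ∈ V := ⟨by linarith [neg_abs_le p.1.im], by linarith⟩
  have hterm : ∀ (n : ℕ) (y : ℂ × ℂ), cexp2 (y.1 + (n + 1) * y.2) ≠ 1 →
      DifferentiableAt ℂ (fun y : ℂ × ℂ =>
        ((n : ℂ) + 1) ^ k * geom (y.1 + (n + 1) * y.2)) y := by
    intro n y hy
    refine DifferentiableAt.const_mul (DifferentiableAt.comp y (differentiableAt_geom hy) ?_) _
    fun_prop
  have htail : DifferentiableAt ℂ (fun y : ℂ × ℂ => ∑' n : ℕ, (((n + N : ℕ) : ℂ) + 1) ^ k *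
      geom (y.1 + (((n + N : ℕ) : ℂ) + 1) * y.2)) p := by
    refine (hasFDerivAt_tsum_of_norm_le hV (fun n y hy => (hterm _ y
      (h (n + N) (by omega) y.1 y.2 hy.1.le hy.2.le).1).differentiableWithinAt)
      ((summable_nat_add_iff N).2 ((summable_nat_add_one_pow_mul_geometric k h0 h1).mul_left C))
      (fun n y hy => ?_) hpV).2.differentiableAt
    rw [norm_mul, norm_pow]
    have h2 : ‖((n + N : ℕ) : ℂ) + 1‖ = ((n + N : ℕ) : ℝ) + 1 := by
      exact_mod_cast Complex.norm_natCast (n + N + 1)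
    calc _ ≤ (((n + N : ℕ) : ℝ) + 1) ^ k * (C * ρ ^ (n + N)) := by
          rw [h2]; gcongr; exact (h (n + N) (by omega) y.1 y.2 hy.1.le hy.2.le).2
      _ = _ := by ring
  have hsum : DifferentiableAt ℂ (fun y : ℂ × ℂ => ∑ n ∈ Finset.range N, ((n : ℂ) + 1) ^ k *
      geom (y.1 + ((n : ℂ) + 1) * y.2)) p :=
    DifferentiableAt.fun_sum fun n _ => hterm n p (hp n)
  refine (hsum.add htail).congr_of_eventuallyEq ?_
  filter_upwards [hV.mem_nhds hpV] with y hy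
  exact ((summable_norm_lambert k y.1 (by linarith [hy.2])).of_norm.sum_add_tsum_nat_add N).symm

lemma cexp2_ne_one_of_mem_domain {p : ℂ × ℂ} (hp : p ∈ domain) :
    cexp2 p.1 ≠ 1 ∧ (∀ n : ℕ, cexp2 (p.1 + (n + 1) * p.2) ≠ 1) ∧
      ∀ n : ℕ, cexp2 (-p.1 + (n + 1) * p.2) ≠ 1 := by
  have h := cexp2_add_mul_ne_one hp.2
  refine ⟨by simpa using h 0, fun n => by exact_mod_cast h (n + 1), fun n h1 => h (-(n + 1)) ?_⟩
  rw [show p.1 + ((-(n + 1) : ℤ) : ℂ) * p.2 = -(-p.1 + (n + 1) * p.2) by push_cast; ring,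
    cexp2_neg, h1, inv_one]

lemma differentiableOn_thetaA : DifferentiableOn ℂ thetaA domain := by
  intro p hp
  obtain ⟨h0, h1, h2⟩ := cexp2_ne_one_of_mem_domain hp
  have hg : DifferentiableAt ℂ (fun p : ℂ × ℂ => geom p.1) p :=
    DifferentiableAt.comp p (differentiableAt_geom h0) differentiableAt_fst
  have hl := differentiableAt_lambert 0 (p := (-p.1, p.2)) hp.1 h2
  have hl' : DifferentiableAt ℂ (fun p : ℂ × ℂ => lambert 0 (-p.1) p.2) p :=
    DifferentiableAt.comp (f := fun p : ℂ × ℂ => (-p.1, p.2)) p hl (by fun_prop)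
  exact (((hg.const_add _).add (differentiableAt_lambert 0 hp.1 h1)).sub
    hl').differentiableWithinAt

lemma differentiableOn_thetaB : DifferentiableOn ℂ thetaB domain := by
  intro p hp
  obtain ⟨h0, h1, h2⟩ := cexp2_ne_one_of_mem_domain hp
  have hl := differentiableAt_lambert 1 (p := (-p.1, p.2)) hp.1 h2
  have hl' : DifferentiableAt ℂ (fun p : ℂ × ℂ => lambert 1 (-p.1) p.2) p :=
    DifferentiableAt.comp (f := fun p : ℂ × ℂ => (-p.1, p.2)) p hl (by fun_prop)
  exact (((differentiableAt_lambert 1 hp.1 h1).const_add _).add hl').differentiableWithinAt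

/-! ### The addition theorem -/

/-- The function `(1 + w) / (2 (1 - w))` of `w = q ^ n e^{2πiz}`, which tends to `1/2` and `-1/2`
as `n → ∞` and `n → -∞`. -/
def halfCot (z τ : ℂ) (n : ℤ) : ℂ := 1 / (1 - cexp2 (z + n * τ)) - 1 / 2

/-- This also holds when `e^{2πix} = 1`, where both sides are divisions by zero. -/
lemma inv_one_sub_cexp2_eq_neg_geom (x : ℂ) : 1 / (1 - cexp2 x) = -geom (-x) := by
  have h0 := cexp2_ne_zero x
  rw [geom, cexp2_neg]
  by_cases h : cexp2 x = 1
  · simp [h]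
  · have h1 : 1 - cexp2 x ≠ 0 := sub_ne_zero.2 (Ne.symm h)
    have h2 : 1 - (cexp2 x)⁻¹ ≠ 0 := sub_ne_zero.2 fun h3 => h (inv_eq_one.1 h3.symm)
    have h3 : cexp2 x - 1 ≠ 0 := sub_ne_zero.2 h
    field_simp
    ring

lemma inv_one_sub_cexp2_eq_geom_add_one {x : ℂ} (h : cexp2 x ≠ 1) :
    1 / (1 - cexp2 x) = geom x + 1 := by
  have h1 : 1 - cexp2 x ≠ 0 := sub_ne_zero.2 (Ne.symm h)
  rw [geom]
  field_simp
  ring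

/-- The terms that remain of `halfCot` after its limits at both ends are subtracted are those of
the Lambert series. -/
lemma halfCot_sub_sign {z τ : ℂ} (h : ∀ m n : ℤ, z ≠ m + n * τ) :
    (halfCot z τ 0 - ((0 : ℤ).sign : ℤ) / 2 = 1 / 2 + geom z) ∧
    (∀ n : ℕ, halfCot z τ (n + 1 : ℕ) - (((n + 1 : ℕ) : ℤ).sign : ℤ) / 2 =
      geom (z + (n + 1) * τ)) ∧
    ∀ n : ℕ, halfCot z τ (-(n + 1)) - ((-((n : ℤ) + 1)).sign : ℤ) / 2 =
      -geom (-z + (n + 1) * τ) := by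
  have h' := cexp2_add_mul_ne_one h
  refine ⟨?_, fun n => ?_, fun n => ?_⟩
  · rw [halfCot, inv_one_sub_cexp2_eq_geom_add_one (h' 0)]
    simp; ring
  · rw [halfCot, inv_one_sub_cexp2_eq_geom_add_one (h' _), Int.sign_eq_one_of_pos (by omega)]
    push_cast; ring
  · rw [halfCot, inv_one_sub_cexp2_eq_neg_geom, Int.sign_eq_neg_one_of_neg (by omega)]
    push_cast
    rw [show -(z + -((n : ℂ) + 1) * τ) = -z + (n + 1) * τ by ring]
    ring

/-- The values `f^{(3,0)}` and `f^{(2,1)}` as regularized sums over `ℤ`. -/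
lemma thetaA_thetaB_eq_tsum {z τ : ℂ} (hτ : 0 < τ.im) (h : ∀ m n : ℤ, z ≠ m + n * τ) :
    Summable (fun n : ℤ => ‖halfCot z τ n - (n.sign : ℤ) / 2‖) ∧
    Summable (fun n : ℤ => ‖(n : ℂ) * (halfCot z τ n - (n.sign : ℤ) / 2)‖) ∧
    ∑' n : ℤ, (halfCot z τ n - (n.sign : ℤ) / 2) = thetaA (z, τ) ∧
    ∑' n : ℤ, (n : ℂ) * (halfCot z τ n - (n.sign : ℤ) / 2) = thetaB (z, τ) + 1 / 12 := by
  obtain ⟨h0, h1, h2⟩ := halfCot_sub_sign h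
  have s0 := summable_norm_lambert 0 z hτ
  have s1 := summable_norm_lambert 1 z hτ
  have t0 := summable_norm_lambert 0 (-z) hτ
  have t1 := summable_norm_lambert 1 (-z) hτ
  simp only [pow_zero, one_mul, pow_one] at s0 s1 t0 t1
  have A1 : HasSum (fun n : ℕ => halfCot z τ n - ((n : ℤ).sign : ℤ) / 2)
      (1 / 2 + geom z + lambert 0 z τ) := by
    rw [← hasSum_nat_add_iff' 1]
    simp only [Finset.sum_range_one, h1]
    convert! s0.of_norm.hasSum using 1
    have : halfCot z τ ((0 : ℕ) : ℤ) - ((((0 : ℕ) : ℤ).sign : ℤ) : ℂ) / 2 = 1 / 2 + geom z := h0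
    rw [this, lambert]; simp
  have A2 : HasSum (fun n : ℕ => halfCot z τ (-(n + 1)) - ((-((n : ℤ) + 1)).sign : ℤ) / 2)
      (-lambert 0 (-z) τ) := by
    simp only [h2]
    convert! t0.of_norm.hasSum.neg using 1
    simp [lambert]
  have B1 : HasSum (fun n : ℕ => ((n : ℤ) : ℂ) * (halfCot z τ n - ((n : ℤ).sign : ℤ) / 2))
      (lambert 1 z τ) := by
    rw [← hasSum_nat_add_iff' 1]
    simp only [Finset.sum_range_one, h1]
    convert! s1.of_norm.hasSum using 1
    · ext n; push_cast; ring
    · simp [lambert]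
  have B2 : HasSum (fun n : ℕ => ((-((n : ℤ) + 1) : ℤ) : ℂ) *
      (halfCot z τ (-(n + 1)) - ((-((n : ℤ) + 1)).sign : ℤ) / 2)) (lambert 1 (-z) τ) := by
    simp only [h2]
    convert! t1.of_norm.hasSum using 1
    · ext n; push_cast; ring
    · simp [lambert]
  refine ⟨?_, ?_, ?_, ?_⟩
  · refine Summable.of_nat_of_neg_add_one ?_ ?_
    · rw [← summable_nat_add_iff 1]
      simpa only [h1] using s0
    · simpa only [h2, norm_neg] using t0
  · refine Summable.of_nat_of_neg_add_one ?_ ?_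
    · rw [← summable_nat_add_iff 1]
      simp only [h1]
      refine s1.congr fun n => ?_
      push_cast; rfl
    · simp only [h2]
      refine t1.congr fun n => ?_
      push_cast; congr 1; ring
  · have h3 := HasSum.of_nat_of_neg_add_one
      (f := fun n : ℤ => halfCot z τ n - (n.sign : ℤ) / 2) A1 A2
    rw [h3.tsum_eq, thetaA]; ring
  · have h3 := HasSum.of_nat_of_neg_add_one
      (f := fun n : ℤ => (n : ℂ) * (halfCot z τ n - (n.sign : ℤ) / 2)) B1 B2
    rw [h3.tsum_eq, thetaB]; ring

/-- The addition theorem `A(x)A(y) + A(y)A(z) + A(z)A(x) = B(x) + B(y) + B(z)` for `x + y + z = 0`.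
For the trigonometric functions `(1 + w) / (2 (1 - w))` it is the elementary identity with the
right hand side `-1/4`; this is summed over the translates by the lattice. -/
theorem thetaA_mul_add_of_add_eq_zero {x y z τ : ℂ} (hτ : 0 < τ.im) (hxyz : x + y + z = 0)
    (hx : ∀ m n : ℤ, x ≠ m + n * τ) (hy : ∀ m n : ℤ, y ≠ m + n * τ)
    (hz : ∀ m n : ℤ, z ≠ m + n * τ) :
    thetaA (x, τ) * thetaA (y, τ) + thetaA (y, τ) * thetaA (z, τ) +
      thetaA (z, τ) * thetaA (x, τ) = thetaB (x, τ) + thetaB (y, τ) + thetaB (z, τ) := by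
  obtain ⟨a1, a2, a3, a4⟩ := thetaA_thetaB_eq_tsum hτ hx
  obtain ⟨b1, b2, b3, b4⟩ := thetaA_thetaB_eq_tsum hτ hy
  obtain ⟨c1, c2, c3, c4⟩ := thetaA_thetaB_eq_tsum hτ hz
  have key := tsum_mul_add_eq_of_sign_regularized (fun n m => ?_) a1 b1 c1 a2 b2 c2
  · rw [a3, a4, b3, b4, c3, c4] at key
    linear_combination key
  · have h1 := sub_ne_zero.2 (cexp2_add_mul_ne_one hx n).symm
    have h2 := sub_ne_zero.2 (cexp2_add_mul_ne_one hy m).symm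
    have h3 := sub_ne_zero.2 (cexp2_add_mul_ne_one hz (-n - m)).symm
    have hprod : cexp2 (x + n * τ) * cexp2 (y + m * τ) * cexp2 (z + (-n - m : ℤ) * τ) = 1 := by
      rw [← cexp2_add, ← cexp2_add, cexp2_eq_one_iff]
      exact ⟨0, by push_cast; linear_combination hxyz⟩
    simp only [halfCot]
    generalize cexp2 (x + n * τ) = X at *
    generalize cexp2 (y + m * τ) = Y at *
    generalize cexp2 (z + (-n - m : ℤ) * τ) = Z at *
    field_simp
    linear_combination (-16 : ℂ) * hprod

lemma thetaA_neg {p : ℂ × ℂ} (hp : p ∈ domain) : thetaA (-p.1, p.2) = -thetaA p := by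
  obtain ⟨h0, -, -⟩ := cexp2_ne_one_of_mem_domain hp
  have h1 := inv_one_sub_cexp2_eq_neg_geom p.1
  rw [inv_one_sub_cexp2_eq_geom_add_one h0] at h1
  simp only [thetaA, neg_neg]
  linear_combination h1

lemma thetaB_neg (p : ℂ × ℂ) : thetaB (-p.1, p.2) = thetaB p := by
  simp only [thetaB, neg_neg]; ring

lemma neg_ne_int_add_int_mul {x τ : ℂ} (hx : ∀ m n : ℤ, x ≠ m + n * τ) (m n : ℤ) :
    -x ≠ m + n * τ := fun h => hx (-m) (-n) (by push_cast; linear_combination -h)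

/-- The contribution of a triple of roots `γ + δ = ε` to the identities of rank two; for the root
system `A₂` it is the identity itself. -/
theorem thetaA_add {x y τ : ℂ} (hτ : 0 < τ.im)
    (hx : ∀ m n : ℤ, x ≠ m + n * τ) (hy : ∀ m n : ℤ, y ≠ m + n * τ)
    (hxy : ∀ m n : ℤ, x + y ≠ m + n * τ) :
    -thetaA (x, τ) * thetaA (y, τ) + thetaA (x, τ) * thetaA (x + y, τ) +
      thetaA (y, τ) * thetaA (x + y, τ) +
      (thetaB (x, τ) + thetaB (y, τ) + thetaB (x + y, τ)) = 0 := by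
  have h := thetaA_mul_add_of_add_eq_zero (z := -(x + y)) hτ (by ring) hx hy
    (neg_ne_int_add_int_mul hxy)
  have e1 : thetaA (-(x + y), τ) = -thetaA (x + y, τ) := thetaA_neg (p := (x + y, τ)) ⟨hτ, hxy⟩
  have e2 : thetaB (-(x + y), τ) = thetaB (x + y, τ) := thetaB_neg (x + y, τ)
  rw [e1, e2] at h
  linear_combination -h

/-! ### Polylogarithms in the variable `x`, where the argument is `e^{2πix}` -/

/-- The polylogarithm `Li_r(e^{2πix})`, for `x` in the upper half plane. -/
def lam (r : ℕ) (x : ℂ) : ℂ := polylog r (cexp2 x)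

lemma norm_cexp2_lt_one {x : ℂ} (hx : 0 < x.im) : ‖cexp2 x‖ < 1 := by
  rw [norm_cexp2, ← Real.exp_zero, Real.exp_lt_exp]
  exact neg_lt_zero.2 (by positivity)

lemma norm_polylog_term_le (r : ℕ) (w : ℂ) (n : ℕ) :
    ‖w ^ (n + 1) / ((n : ℂ) + 1) ^ r‖ ≤ ‖w‖ * ‖w‖ ^ n := by
  have h2 : ‖(n : ℂ) + 1‖ = (n : ℝ) + 1 := by exact_mod_cast Complex.norm_natCast (n + 1)
  rw [norm_div, norm_pow, norm_pow, h2, ← pow_succ']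
  refine div_le_self (by positivity) (one_le_pow₀ ?_)
  have : (0 : ℝ) ≤ n := n.cast_nonneg
  linarith

lemma norm_polylog_le (r : ℕ) {w : ℂ} (hw : ‖w‖ < 1) : ‖polylog r w‖ ≤ ‖w‖ / (1 - ‖w‖) := by
  rw [div_eq_mul_inv]
  exact tsum_of_norm_bounded ((hasSum_geometric_of_lt_one (norm_nonneg w) hw).mul_left ‖w‖)
    (norm_polylog_term_le r w)

lemma lam_zero {x : ℂ} (hx : 0 < x.im) : lam 0 x = geom x := by
  rw [geom, div_eq_mul_inv]
  have := (hasSum_geometric_of_norm_lt_one (norm_cexp2_lt_one hx)).mul_left (cexp2 x)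
  rw [← this.tsum_eq, lam, polylog]
  simp [pow_succ']

lemma hasDerivAt_lam (r : ℕ) {x : ℂ} (hx : 0 < x.im) :
    HasDerivAt (lam (r + 1)) (2 * Real.pi * I * lam r x) x := by
  set V : Set ℂ := {y | x.im / 2 < y.im} with hV
  have hVo : IsOpen V := isOpen_lt continuous_const continuous_im
  have hxV : x ∈ V := half_lt_self hx
  set ρ := Real.exp (-(2 * Real.pi * (x.im / 2))) with hρ
  have hρ1 : ρ < 1 := by
    rw [hρ, ← Real.exp_zero, Real.exp_lt_exp]
    exact neg_lt_zero.2 (by positivity)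
  have hle : ∀ y ∈ V, ‖cexp2 y‖ ≤ ρ := fun y hy => by
    rw [norm_cexp2, hρ, Real.exp_le_exp]
    have : 2 * Real.pi * (x.im / 2) ≤ 2 * Real.pi * y.im := by gcongr; exact le_of_lt hy
    linarith
  have hterm : ∀ (n : ℕ) (y : ℂ), HasDerivAt
      (fun y => cexp2 y ^ (n + 1) / ((n : ℂ) + 1) ^ (r + 1))
      (2 * Real.pi * I * (cexp2 y ^ (n + 1) / ((n : ℂ) + 1) ^ r)) y := fun n y => by
    convert! ((hasDerivAt_cexp2 y).pow (n + 1)).div_const (((n : ℂ) + 1) ^ (r + 1)) using 1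
    have : (n : ℂ) + 1 ≠ 0 := n.cast_add_one_ne_zero
    push_cast
    field_simp
    ring
  have h := hasFDerivAt_tsum_of_norm_le hVo
    (f := fun (n : ℕ) y => cexp2 y ^ (n + 1) / ((n : ℂ) + 1) ^ (r + 1))
    (fun n y _ => (hterm n y).differentiableAt.differentiableWithinAt)
    ((summable_geometric_of_lt_one (Real.exp_pos _).le hρ1).mul_left ρ)
    (fun n y hy => (norm_polylog_term_le _ _ n).trans (by gcongr <;> exact hle y hy)) hxV
  have h2 := h.2.hasDerivAt
  rw [show ∀ L : ℂ →L[ℂ] ℂ, L 1 = ContinuousLinearMap.apply ℂ ℂ (1 : ℂ) L from fun _ => rfl,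
    ContinuousLinearMap.map_tsum _ h.1] at h2
  simp only [ContinuousLinearMap.apply_apply, fderiv_apply_one_eq_deriv, (hterm _ _).deriv, tsum_mul_left] at h2
  exact h2

/-- The weighted polylogarithm series `∑_{n ≥ 1} n ^ k Li_r(q ^ n ζ)`, with `ζ = e^{2πix}` and
`q = e^{2πiτ}`. -/
def polyLambert (r k : ℕ) (x τ : ℂ) : ℂ := ∑' n : ℕ, ((n : ℂ) + 1) ^ k * lam r (x + (n + 1) * τ)

/-- The terms of a weighted polylogarithm series decay geometrically, uniformly on
`Im (x + τ) ≥ a`, `Im τ ≥ b`. -/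
lemma exists_norm_lam_le (r k : ℕ) {a b : ℝ} (ha : 0 < a) (hb : 0 < b) :
    ∃ u : ℕ → ℝ, Summable u ∧ ∀ (n : ℕ) (x τ : ℂ), a ≤ (x + τ).im → b ≤ τ.im →
      ‖((n : ℂ) + 1) ^ k * lam r (x + (n + 1) * τ)‖ ≤ u n := by
  set ρ := Real.exp (-(2 * Real.pi * b)) with hρ
  have hρ1 : ρ < 1 := by
    rw [hρ, ← Real.exp_zero, Real.exp_lt_exp]
    exact neg_lt_zero.2 (by positivity)
  have hρ0 : 0 ≤ ρ := (Real.exp_pos _).le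
  set K := Real.exp (2 * Real.pi * (-a)) with hK
  have hK1 : K < 1 := by
    rw [hK, ← Real.exp_zero, Real.exp_lt_exp, mul_neg]
    exact neg_lt_zero.2 (by positivity)
  have hK0 : 0 ≤ K := (Real.exp_pos _).le
  refine ⟨_, (summable_nat_add_one_pow_mul_geometric k hρ0 hρ1).mul_left (K / (1 - K)),
    fun n x τ hx hτ => ?_⟩
  have h2 : ‖(n : ℂ) + 1‖ = (n : ℝ) + 1 := by exact_mod_cast Complex.norm_natCast (n + 1)
  have h1 := norm_cexp2_add_mul_le (a := -a) (x := x + τ) (by simpa using hx) hτ n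
  rw [show x + τ + n * τ = x + (n + 1) * τ by ring] at h1
  set w := cexp2 (x + (n + 1) * τ) with hw
  have h3 : ‖w‖ ≤ K := h1.trans (mul_le_of_le_one_right hK0 (pow_le_one₀ hρ0 hρ1.le))
  rw [norm_mul, norm_pow, h2, lam, ← hw]
  calc _ ≤ ((n : ℝ) + 1) ^ k * ((K * ρ ^ n) / (1 - K)) := by
        gcongr
        refine (norm_polylog_le r (h3.trans_lt hK1)).trans ?_
        gcongr
    _ = _ := by ring

lemma summable_norm_polyLambert (r k : ℕ) {x τ : ℂ} (hx : 0 < (x + τ).im) (hτ : 0 < τ.im) :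
    Summable fun n : ℕ => ‖((n : ℂ) + 1) ^ k * lam r (x + (n + 1) * τ)‖ := by
  obtain ⟨u, hu, h⟩ := exists_norm_lam_le r k hx hτ
  exact .of_norm_bounded hu fun n => by rw [norm_norm]; exact h n x τ le_rfl le_rfl

lemma im_add_mul_pos {x τ : ℂ} (hx : 0 < (x + τ).im) (hτ : 0 < τ.im) (n : ℕ) :
    0 < (x + (n + 1) * τ).im := by
  have : (x + (n + 1) * τ).im = (x + τ).im + n * τ.im := by simp; ring
  rw [this]; positivity

lemma polyLambert_zero (k : ℕ) {x τ : ℂ} (hx : 0 < (x + τ).im) (hτ : 0 < τ.im) :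
    polyLambert 0 k x τ = lambert k x τ :=
  tsum_congr fun n => by rw [lam_zero (im_add_mul_pos hx hτ n)]

/-- Both partial derivatives lower the order of the polylogarithms; the one in `τ` also raises the
weight. -/
theorem hasFDerivAt_polyLambert (r k : ℕ) {p : ℂ × ℂ} (hx : 0 < (p.1 + p.2).im)
    (hτ : 0 < p.2.im) :
    HasFDerivAt (fun p : ℂ × ℂ => polyLambert (r + 1) k p.1 p.2)
      ((2 * Real.pi * I * polyLambert r k p.1 p.2) • ContinuousLinearMap.fst ℂ ℂ ℂ +
        (2 * Real.pi * I * polyLambert r (k + 1) p.1 p.2) • ContinuousLinearMap.snd ℂ ℂ ℂ) p := by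
  obtain ⟨u, hu, hub⟩ := exists_norm_lam_le (r + 1) k (half_pos hx) (half_pos hτ)
  set V : Set (ℂ × ℂ) := {y | (p.1 + p.2).im / 2 < (y.1 + y.2).im ∧ p.2.im / 2 < y.2.im} with hVdef
  have hV : IsOpen V := by
    rw [hVdef]; simp only [ofPred_and]
    exact (isOpen_lt continuous_const (by fun_prop)).inter
      (isOpen_lt continuous_const (by fun_prop))
  have hpV : p ∈ V := ⟨half_lt_self hx, half_lt_self hτ⟩
  have hterm : ∀ (n : ℕ), ∀ y ∈ V,
      HasFDerivAt (fun y : ℂ × ℂ => ((n : ℂ) + 1) ^ k * lam (r + 1) (y.1 + (n + 1) * y.2))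
        ((2 * Real.pi * I * (((n : ℂ) + 1) ^ k * lam r (y.1 + (n + 1) * y.2))) •
            ContinuousLinearMap.fst ℂ ℂ ℂ +
          (2 * Real.pi * I * (((n : ℂ) + 1) ^ (k + 1) * lam r (y.1 + (n + 1) * y.2))) •
            ContinuousLinearMap.snd ℂ ℂ ℂ) y := by
    intro n y hy
    have h1 := hasDerivAt_lam r (im_add_mul_pos ((half_pos hx).trans hy.1)
      ((half_pos hτ).trans hy.2) n)
    have h2 : HasFDerivAt (fun y : ℂ × ℂ => y.1 + (n + 1) * y.2)
        (ContinuousLinearMap.fst ℂ ℂ ℂ + ((n : ℂ) + 1) • ContinuousLinearMap.snd ℂ ℂ ℂ) y :=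
      hasFDerivAt_fst.add (hasFDerivAt_snd.const_mul _)
    convert! (h1.comp_hasFDerivAt y h2).const_mul (((n : ℂ) + 1) ^ k) using 1
    ext <;> simp <;> ring
  have h := hasFDerivAt_tsum_of_norm_le hV
    (f := fun (n : ℕ) (y : ℂ × ℂ) => ((n : ℂ) + 1) ^ k * lam (r + 1) (y.1 + (n + 1) * y.2))
    (fun n y hy => (hterm n y hy).differentiableAt.differentiableWithinAt) hu
    (fun n y hy => hub n y.1 y.2 hy.1.le hy.2.le) hpV
  simp only [(hterm _ p hpV).fderiv] at h
  have s1 := ((summable_norm_polyLambert r k hx hτ).of_norm.hasSum.mul_left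
    (2 * Real.pi * I)).smul_const (ContinuousLinearMap.fst ℂ ℂ ℂ)
  have s2 := ((summable_norm_polyLambert r (k + 1) hx hτ).of_norm.hasSum.mul_left
    (2 * Real.pi * I)).smul_const (ContinuousLinearMap.snd ℂ ℂ ℂ)
  rw [(s1.add s2).tsum_eq] at h
  exact h.2

lemma hasDerivAt_polyLambert_left (r k : ℕ) {x τ : ℂ} (hx : 0 < (x + τ).im) (hτ : 0 < τ.im) :
    HasDerivAt (fun x => polyLambert (r + 1) k x τ) (2 * Real.pi * I * polyLambert r k x τ) x := by
  have h := hasFDerivAt_polyLambert r k (p := (x, τ)) hx hτ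
  have h2 : HasDerivAt (fun x : ℂ => (x, τ)) ((1 : ℂ), (0 : ℂ)) x :=
    (hasDerivAt_id x).prodMk (hasDerivAt_const x τ)
  simpa [Function.comp_def] using h.comp_hasDerivAt x h2

lemma hasDerivAt_polyLambert_right (r k : ℕ) {x τ : ℂ} (hx : 0 < (x + τ).im) (hτ : 0 < τ.im) :
    HasDerivAt (fun τ => polyLambert (r + 1) k x τ)
      (2 * Real.pi * I * polyLambert r (k + 1) x τ) τ := by
  have h := hasFDerivAt_polyLambert r k (p := (x, τ)) hx hτ
  have h2 : HasDerivAt (fun τ : ℂ => (x, τ)) ((0 : ℂ), (1 : ℂ)) τ :=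
    (hasDerivAt_const τ x).prodMk (hasDerivAt_id τ)
  simpa [Function.comp_def] using h.comp_hasDerivAt τ h2

lemma hasDerivAt_polyLambert_neg_left (r k : ℕ) {x τ : ℂ} (hx : 0 < (-x + τ).im)
    (hτ : 0 < τ.im) :
    HasDerivAt (fun x => polyLambert (r + 1) k (-x) τ)
      (-(2 * Real.pi * I * polyLambert r k (-x) τ)) x := by
  simpa [Function.comp_def] using (hasDerivAt_polyLambert_left r k hx hτ).comp x (hasDerivAt_neg x)

/-! ### The elliptic trilogarithm and its derivatives on the strip -/

lemma chi_three (u t : ℂ) : chi 3 u t = -u ^ 3 / 12 + u ^ 2 * t / 24 - t ^ 3 / 720 := by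
  have b3 : bernoulli 3 = 0 := by
    rw [bernoulli_eq_bernoulli'_of_ne_one (by norm_num), bernoulli'_three]
  have b4 : bernoulli 4 = -1 / 30 := by
    rw [bernoulli_eq_bernoulli'_of_ne_one (by norm_num), bernoulli'_four]
  simp only [chi, Finset.sum_range_succ, Finset.sum_range_zero, bernoulli_one, bernoulli_two, b3,
    b4, zero_add, Nat.reduceAdd, Nat.reduceSub, Nat.factorial]
  push_cast
  ring

/-- The part of `(2πi)³ f(z, τ)` that is holomorphic on `|Im z| < Im τ`: all of it but
`Li₃(e^{2πiz})`. -/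
def regularPart (p : ℂ × ℂ) : ℂ :=
  polyLambert 3 0 p.1 p.2 + polyLambert 3 0 (-p.1) p.2
    - chi 3 (2 * Real.pi * I * p.1) (2 * Real.pi * I * p.2)
    - ellipticPolylog 3 0 (2 * Real.pi * I * p.2)

lemma polylog_exp (r n : ℕ) (u τ : ℂ) :
    polylog r (exp (2 * Real.pi * I * τ) ^ n * exp (2 * Real.pi * I * u)) = lam r (u + n * τ) := by
  rw [lam, cexp2, ← exp_nat_mul, ← exp_add]
  congr 2; ring

lemma ellipticPolylog_eq {r : ℕ} {z τ : ℂ} (hz : 0 < (z + τ).im) (hτ : 0 < τ.im) :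
    ellipticPolylog r (2 * Real.pi * I * z) (2 * Real.pi * I * τ) =
      lam r z + polyLambert r 0 z τ + polyLambert r 0 (-z) τ
        - chi r (2 * Real.pi * I * z) (2 * Real.pi * I * τ) := by
  have hs := (summable_norm_polyLambert r 0 hz hτ).of_norm
  simp only [pow_zero, one_mul] at hs
  have h1 : ∑' n : ℕ, lam r (z + n * τ) = lam r z + polyLambert r 0 z τ := by
    rw [((summable_nat_add_iff 1).1 (by simpa using hs)).tsum_eq_zero_add]
    simp [polyLambert]
  rw [ellipticPolylog, ← exp_neg, ← mul_neg]
  simp only [polylog_exp]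
  rw [h1]
  simp [polyLambert]

lemma trilog_eq {p : ℂ × ℂ} (hz : 0 < (p.1 + p.2).im) (hτ : 0 < p.2.im) :
    trilog p = 1 / (2 * Real.pi * I) ^ 3 * (lam 3 p.1 + regularPart p) := by
  rw [trilog, ellipticPolylog_eq hz hτ, regularPart]
  ring

lemma differentiableAt_ellipticPolylog_zero {τ : ℂ} (hτ : 0 < τ.im) :
    DifferentiableAt ℂ (fun τ => ellipticPolylog 3 0 (2 * Real.pi * I * τ)) τ := by
  have h : ∀ᶠ y in 𝓝 τ, 0 < y.im := (isOpen_lt continuous_const continuous_im).mem_nhds hτ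
  have he : (fun τ => ellipticPolylog 3 0 (2 * Real.pi * I * τ)) =ᶠ[𝓝 τ] fun τ =>
      lam 3 0 + polyLambert 3 0 0 τ + polyLambert 3 0 0 τ
        - (-0 ^ 3 / 12 + 0 ^ 2 * (2 * Real.pi * I * τ) / 24 - (2 * Real.pi * I * τ) ^ 3 / 720) := by
    filter_upwards [h] with y hy
    have := ellipticPolylog_eq (r := 3) (z := 0) (τ := y) (by simpa using hy) hy
    simpa [chi_three] using this
  refine DifferentiableAt.congr_of_eventuallyEq ?_ he
  have hd := (hasDerivAt_polyLambert_right 2 0 (x := 0) (by simpa using hτ) hτ).differentiableAt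
  exact ((hd.const_add _).add hd).sub (by fun_prop)

lemma differentiableAt_regularPart {p : ℂ × ℂ} (h1 : 0 < (p.1 + p.2).im)
    (h2 : 0 < (-p.1 + p.2).im) (hτ : 0 < p.2.im) : DifferentiableAt ℂ regularPart p := by
  have d1 := (hasFDerivAt_polyLambert 2 0 h1 hτ).differentiableAt
  have d2 : DifferentiableAt ℂ (fun p : ℂ × ℂ => polyLambert 3 0 (-p.1) p.2) p :=
    DifferentiableAt.comp (f := fun p : ℂ × ℂ => (-p.1, p.2)) p
      (hasFDerivAt_polyLambert 2 0 (p := (-p.1, p.2)) h2 hτ).differentiableAt (by fun_prop)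
  have d3 : DifferentiableAt ℂ
      (fun p : ℂ × ℂ => chi 3 (2 * Real.pi * I * p.1) (2 * Real.pi * I * p.2)) p := by
    simp only [chi_three]; fun_prop
  have d4 : DifferentiableAt ℂ (fun p : ℂ × ℂ => ellipticPolylog 3 0 (2 * Real.pi * I * p.2)) p :=
    DifferentiableAt.comp p (differentiableAt_ellipticPolylog_zero hτ) differentiableAt_snd
  exact ((d1.add d2).sub d3).sub d4

lemma im_pos_of_mem_strip {p : ℂ × ℂ} (hp : p ∈ strip) :
    0 < p.1.im ∧ 0 < p.2.im ∧ 0 < (p.1 + p.2).im ∧ 0 < (-p.1 + p.2).im := by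
  obtain ⟨h1, h2⟩ := hp
  simp only [add_im, neg_im]
  refine ⟨h1, ?_, ?_, ?_⟩ <;> linarith

lemma isOpen_strip : IsOpen strip := by
  simp only [strip, ofPred_and]
  exact (isOpen_lt continuous_const (by fun_prop)).inter (isOpen_lt (by fun_prop) (by fun_prop))

lemma differentiableOn_trilog : DifferentiableOn ℂ trilog strip := by
  intro p hp
  obtain ⟨h1, h2, h3, h4⟩ := im_pos_of_mem_strip hp
  have d : DifferentiableAt ℂ (fun p : ℂ × ℂ => lam 3 p.1) p :=
    DifferentiableAt.comp (g := lam 3) p (hasDerivAt_lam 2 h1).differentiableAt differentiableAt_fst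
  refine DifferentiableAt.differentiableWithinAt (DifferentiableAt.congr_of_eventuallyEq
    ((d.add (differentiableAt_regularPart h3 h4 h2)).const_mul (1 / (2 * Real.pi * I) ^ 3)) ?_)
  filter_upwards [isOpen_strip.mem_nhds hp] with y hy
  obtain ⟨_, k2, k3, _⟩ := im_pos_of_mem_strip hy
  exact trilog_eq k3 k2

lemma iteratedDeriv_succ_eqOn {f g g' : ℂ → ℂ} {U : Set ℂ} {n : ℕ} (hU : IsOpen U)
    (h : EqOn (iteratedDeriv n f) g U) (hg : ∀ x ∈ U, HasDerivAt g (g' x) x) :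
    EqOn (iteratedDeriv (n + 1) f) g' U := fun x hx => by
  rw [iteratedDeriv_succ]
  exact ((hg x hx).congr_of_eventuallyEq (h.eventuallyEq_of_mem (hU.mem_nhds hx))).deriv

lemma isOpen_strip_slice (τ : ℂ) : IsOpen {z : ℂ | (z, τ) ∈ strip} :=
  isOpen_strip.preimage (by fun_prop)

theorem partialDeriv_three_zero_trilog {p : ℂ × ℂ} (hp : p ∈ strip) :
    partialDeriv 3 0 trilog p = thetaA p := by
  obtain ⟨z₀, τ⟩ := p
  set c : ℂ := 2 * Real.pi * I with hc
  have hc0 : c ≠ 0 := two_pi_I_ne_zero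
  have hU := isOpen_strip_slice τ
  have hpow : ∀ x : ℂ, HasDerivAt (fun z : ℂ => z) 1 x := fun x => hasDerivAt_id x
  have e0 : EqOn (iteratedDeriv 0 fun z => trilog (z, τ)) (fun z => 1 / c ^ 3 * (lam 3 z +
      polyLambert 3 0 z τ + polyLambert 3 0 (-z) τ - chi 3 (c * z) (c * τ)
      - ellipticPolylog 3 0 (c * τ))) {z | (z, τ) ∈ strip} := fun z hz => by
    obtain ⟨_, k2, k3, _⟩ := im_pos_of_mem_strip hz
    rw [iteratedDeriv_zero, trilog_eq k3 k2, regularPart, ← hc]; ring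
  have e1 := iteratedDeriv_succ_eqOn hU e0 (g' := fun z => 1 / c ^ 3 * (c * lam 2 z +
      c * polyLambert 2 0 z τ - c * polyLambert 2 0 (-z) τ
        - (-c ^ 3 * z ^ 2 / 4 + c ^ 3 * z * τ / 12))) fun z hz => by
    obtain ⟨k1, k2, k3, k4⟩ := im_pos_of_mem_strip hz
    simp only [chi_three]
    convert! (((((hasDerivAt_lam 2 k1).add (hasDerivAt_polyLambert_left 2 0 k3 k2)).add
      (hasDerivAt_polyLambert_neg_left 2 0 k4 k2)).sub
      ((((((hpow z).const_mul c).pow 3).neg.div_const 12).add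
        (((((hpow z).const_mul c).pow 2).mul_const (c * τ)).div_const 24)).sub_const
        ((c * τ) ^ 3 / 720))).sub_const (ellipticPolylog 3 0 (c * τ))).const_mul (1 / c ^ 3) using 1
    simp only [← hc]; push_cast; ring
  have e2 := iteratedDeriv_succ_eqOn hU e1 (g' := fun z => 1 / c ^ 3 * (c ^ 2 * lam 1 z +
      c ^ 2 * polyLambert 1 0 z τ + c ^ 2 * polyLambert 1 0 (-z) τ
        - (-c ^ 3 * z / 2 + c ^ 3 * τ / 12))) fun z hz => by
    obtain ⟨k1, k2, k3, k4⟩ := im_pos_of_mem_strip hz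
    convert! (((((hasDerivAt_lam 1 k1).const_mul c).add
      ((hasDerivAt_polyLambert_left 1 0 k3 k2).const_mul c)).sub
      ((hasDerivAt_polyLambert_neg_left 1 0 k4 k2).const_mul c)).sub
      (((((hpow z).pow 2).const_mul (-c ^ 3)).div_const 4).add
        ((((hpow z).const_mul (c ^ 3)).mul_const τ).div_const 12))).const_mul (1 / c ^ 3) using 1
    simp only [← hc]; push_cast; ring
  have e3 := iteratedDeriv_succ_eqOn hU e2 (g' := fun z => 1 / c ^ 3 * (c ^ 3 * lam 0 z +
      c ^ 3 * polyLambert 0 0 z τ - c ^ 3 * polyLambert 0 0 (-z) τ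
        - (-c ^ 3 / 2))) fun z hz => by
    obtain ⟨k1, k2, k3, k4⟩ := im_pos_of_mem_strip hz
    convert! (((((hasDerivAt_lam 0 k1).const_mul (c ^ 2)).add
      ((hasDerivAt_polyLambert_left 0 0 k3 k2).const_mul (c ^ 2))).add
      ((hasDerivAt_polyLambert_neg_left 0 0 k4 k2).const_mul (c ^ 2))).sub
      ((((hpow z).const_mul (-c ^ 3)).div_const 2).add_const
        (c ^ 3 * τ / 12))).const_mul (1 / c ^ 3) using 1
    simp only [← hc]; ring
  obtain ⟨k1, k2, k3, k4⟩ := im_pos_of_mem_strip hp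
  have := e3 hp
  simp only [partialDeriv, iteratedDeriv_zero]
  refine this.trans ?_
  dsimp only at k1 k2 k3 k4 ⊢
  rw [lam_zero k1, polyLambert_zero 0 k3 k2, polyLambert_zero 0 k4 k2, thetaA]
  field_simp
  ring

theorem partialDeriv_two_one_trilog {p : ℂ × ℂ} (hp : p ∈ strip) :
    partialDeriv 2 1 trilog p = thetaB p := by
  obtain ⟨z₀, τ⟩ := p
  set c : ℂ := 2 * Real.pi * I with hc
  have hc0 : c ≠ 0 := two_pi_I_ne_zero
  have hU := isOpen_strip_slice τ
  have hpow : ∀ x : ℂ, HasDerivAt (fun z : ℂ => z) 1 x := fun x => hasDerivAt_id x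
  set C' := deriv (fun τ => ellipticPolylog 3 0 (c * τ)) τ with hC'
  have e0 : EqOn (iteratedDeriv 0 fun z => deriv (fun τ => trilog (z, τ)) τ) (fun z => 1 / c ^ 3 *
      (c * polyLambert 2 1 z τ + c * polyLambert 2 1 (-z) τ
        - (c ^ 3 * z ^ 2 / 24 - c ^ 3 * τ ^ 2 / 240) - C')) {z | (z, τ) ∈ strip} := fun z hz => by
    obtain ⟨k1, k2, k3, k4⟩ := im_pos_of_mem_strip hz
    rw [iteratedDeriv_zero]
    have hd := (differentiableAt_ellipticPolylog_zero k2).hasDerivAt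
    have hev : (fun τ => trilog (z, τ)) =ᶠ[𝓝 τ] fun τ => 1 / c ^ 3 * (lam 3 z +
      polyLambert 3 0 z τ + polyLambert 3 0 (-z) τ
      - (-(c * z) ^ 3 / 12 + (c * z) ^ 2 * (c * τ) / 24 - (c * τ) ^ 3 / 720)
      - ellipticPolylog 3 0 (c * τ)) := by
      have ho : IsOpen {τ : ℂ | (z, τ) ∈ strip} := isOpen_strip.preimage (by fun_prop)
      filter_upwards [ho.mem_nhds hz] with y hy
      obtain ⟨_, l2, l3, _⟩ := im_pos_of_mem_strip hy
      rw [trilog_eq l3 l2, regularPart, ← hc, chi_three]; ring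
    refine (HasDerivAt.congr_of_eventuallyEq ?_ hev).deriv
    convert! (((((hasDerivAt_polyLambert_right 2 0 k3 k2).const_add (lam 3 z)).add
      (hasDerivAt_polyLambert_right 2 0 k4 k2)).sub
      (((((((hpow τ).const_mul c).const_mul ((c * z) ^ 2)).div_const 24)).const_add
        (-(c * z) ^ 3 / 12)).sub
        ((((hpow τ).const_mul c).pow 3).div_const 720))).sub hd).const_mul (1 / c ^ 3) using 1
    simp only [← hc, ← hC']; push_cast; ring
  have e1 := iteratedDeriv_succ_eqOn hU e0 (g' := fun z => 1 / c ^ 3 *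
      (c ^ 2 * polyLambert 1 1 z τ - c ^ 2 * polyLambert 1 1 (-z) τ
        - c ^ 3 * z / 12)) fun z hz => by
    obtain ⟨k1, k2, k3, k4⟩ := im_pos_of_mem_strip hz
    convert! ((((hasDerivAt_polyLambert_left 1 1 k3 k2).const_mul c).add
      ((hasDerivAt_polyLambert_neg_left 1 1 k4 k2).const_mul c)).sub
      (((((hpow z).pow 2).const_mul (c ^ 3)).div_const 24).sub_const
        (c ^ 3 * τ ^ 2 / 240))).sub_const C' |>.const_mul (1 / c ^ 3) using 1
    simp only [← hc]; push_cast; ring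
  have e2 := iteratedDeriv_succ_eqOn hU e1 (g' := fun z => 1 / c ^ 3 *
      (c ^ 3 * polyLambert 0 1 z τ + c ^ 3 * polyLambert 0 1 (-z) τ
        - c ^ 3 / 12)) fun z hz => by
    obtain ⟨k1, k2, k3, k4⟩ := im_pos_of_mem_strip hz
    convert! ((((hasDerivAt_polyLambert_left 0 1 k3 k2).const_mul (c ^ 2)).sub
      ((hasDerivAt_polyLambert_neg_left 0 1 k4 k2).const_mul (c ^ 2))).sub
      (((hpow z).const_mul (c ^ 3)).div_const 12)).const_mul (1 / c ^ 3) using 1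
    simp only [← hc]; ring
  obtain ⟨k1, k2, k3, k4⟩ := im_pos_of_mem_strip hp
  have := e2 hp
  simp only [partialDeriv, iteratedDeriv_one]
  refine this.trans ?_
  dsimp only at k1 k2 k3 k4 ⊢
  rw [polyLambert_zero 1 k3 k2, polyLambert_zero 1 k4 k2, thetaB]
  field_simp
  ring

/-! ### The derivatives of a branch are single-valued -/

lemma differentiableOn_deriv_right {φ : ℂ × ℂ → ℂ} {V : Set (ℂ × ℂ)} (hV : IsOpen V)
    (hφ : DifferentiableOn ℂ φ V) :
    DifferentiableOn ℂ (fun p : ℂ × ℂ => deriv (fun τ => φ (p.1, τ)) p.2) V := by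
  refine (differentiableOn_fderiv_apply hV hφ (0, 1)).congr fun p hp => ?_
  have h2 : HasDerivAt (fun τ : ℂ => (p.1, τ)) ((0 : ℂ), (1 : ℂ)) p.2 :=
    (hasDerivAt_const _ _).prodMk (hasDerivAt_id _)
  exact ((hφ.differentiableAt (hV.mem_nhds hp)).hasFDerivAt.comp_hasDerivAt p.2 h2).deriv

lemma differentiableOn_iteratedDeriv_left {φ : ℂ × ℂ → ℂ} {V : Set (ℂ × ℂ)} (hV : IsOpen V)
    (hφ : DifferentiableOn ℂ φ V) (n : ℕ) :
    DifferentiableOn ℂ (fun p : ℂ × ℂ => iteratedDeriv n (fun z => φ (z, p.2)) p.1) V := by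
  induction n with
  | zero => simpa using hφ
  | succ n ih =>
    refine (differentiableOn_fderiv_apply hV ih (1, 0)).congr fun p hp => ?_
    rw [iteratedDeriv_succ]
    have h2 : HasDerivAt (fun z : ℂ => (z, p.2)) ((1 : ℂ), (0 : ℂ)) p.1 :=
      (hasDerivAt_id _).prodMk (hasDerivAt_const _ _)
    exact ((ih.differentiableAt (hV.mem_nhds hp)).hasFDerivAt.comp_hasDerivAt p.1 h2).deriv

lemma differentiableOn_partialDeriv {φ : ℂ × ℂ → ℂ} {V : Set (ℂ × ℂ)} (hV : IsOpen V)
    (hφ : DifferentiableOn ℂ φ V) :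
    DifferentiableOn ℂ (partialDeriv 3 0 φ) V ∧ DifferentiableOn ℂ (partialDeriv 2 1 φ) V := by
  constructor
  · exact (differentiableOn_iteratedDeriv_left hV hφ 3).congr fun p _ => by
      simp only [partialDeriv, iteratedDeriv_zero]
  · exact (differentiableOn_iteratedDeriv_left hV (differentiableOn_deriv_right hV hφ) 2).congr
      fun p _ => by simp only [partialDeriv, iteratedDeriv_one]

lemma partialDeriv_congr {g h : ℂ × ℂ → ℂ} {p : ℂ × ℂ} (hgh : g =ᶠ[𝓝 p] h) (n m : ℕ) :
    partialDeriv n m g p = partialDeriv n m h p := by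
  have hc : ∀ᶠ z in 𝓝 p.1, ∀ᶠ τ in 𝓝 p.2, g (z, τ) = h (z, τ) := by
    have : ∀ᶠ x in 𝓝 p.1 ×ˢ 𝓝 p.2, g x = h x := by rw [← nhds_prod_eq]; exact hgh
    exact this.curry
  refine Filter.EventuallyEq.iteratedDeriv_eq n ?_
  filter_upwards [hc] with z hz
  exact Filter.EventuallyEq.iteratedDeriv_eq m hz

lemma strip_subset_domain : strip ⊆ domain := by
  intro p hp
  obtain ⟨h1, h2, -, -⟩ := im_pos_of_mem_strip hp
  refine ⟨h2, fun m n h => ?_⟩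
  have him : p.1.im = n * p.2.im := by rw [h]; simp
  have hlt := hp.2
  rw [him] at h1 hlt
  have n0 : (0 : ℝ) < n := pos_of_mul_pos_left h1 h2.le
  have n1 : (n : ℝ) < 1 := by nlinarith
  norm_cast at n0 n1
  omega

/-- The derivatives `f^{(3,0)}` and `f^{(2,1)}` do not depend on the branch: they are given by
holomorphic functions on the whole domain, hence preserved by analytic continuation. -/
theorem IsBranch.partialDeriv_eq {U : Set (ℂ × ℂ)} {g : ℂ × ℂ → ℂ} (h : IsBranch U g) :
    ∀ p ∈ U, partialDeriv 3 0 g p = thetaA p ∧ partialDeriv 2 1 g p = thetaB p := by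
  induction h with
  | base => exact fun p hp => ⟨partialDeriv_three_zero_trilog hp, partialDeriv_two_one_trilog hp⟩
  | @continuation U V W g h _ ho hc hs hd hWo hWn hW heq ih =>
    obtain ⟨d1, d2⟩ := differentiableOn_partialDeriv ho hd
    have hWU : W ⊆ U := hW.trans inter_subset_left
    have hWV : W ⊆ V := hW.trans inter_subset_right
    have hev : ∀ p ∈ W, h =ᶠ[𝓝 p] g := fun p hp =>
      (heq.eventuallyEq_of_mem (hWo.mem_nhds hp)).symm
    have k1 := eqOn_zero_of_eqOn_open ho hc (d1.sub (differentiableOn_thetaA.mono hs)) hWo hWV hWn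
      fun p hp => by
        rw [Pi.sub_apply, partialDeriv_congr (hev p hp), (ih p (hWU hp)).1, sub_self]
    have k2 := eqOn_zero_of_eqOn_open ho hc (d2.sub (differentiableOn_thetaB.mono hs)) hWo hWV hWn
      fun p hp => by
        rw [Pi.sub_apply, partialDeriv_congr (hev p hp), (ih p (hWU hp)).2, sub_self]
    exact fun p hp => ⟨sub_eq_zero.1 (k1 p hp), sub_eq_zero.1 (k2 p hp)⟩

lemma IsBranchAt.partialDeriv_eq {g : ℂ × ℂ → ℂ} {p : ℂ × ℂ} (h : IsBranchAt g p) :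
    partialDeriv 3 0 g p = thetaA p ∧ partialDeriv 2 1 g p = thetaB p := by
  obtain ⟨U, hU, hp⟩ := h
  exact hU.partialDeriv_eq p hp

/-! ### Existence of branches -/

/-- An automorphism of the domain that carries the initial function element to a branch, up to an
entire function, does so with every branch: continuations can be transported along it. -/
theorem IsBranch.transport {σ : ℂ × ℂ ≃ₜ ℂ × ℂ} (hσ : Differentiable ℂ σ)
    (hdom : σ ⁻¹' domain ⊆ domain) {P : ℂ × ℂ → ℂ} (hP : Differentiable ℂ P)
    (hbase : IsBranch (σ ⁻¹' strip) fun p => trilog (σ p) + P p) {U : Set (ℂ × ℂ)}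
    {g : ℂ × ℂ → ℂ} (h : IsBranch U g) : IsBranch (σ ⁻¹' U) fun p => g (σ p) + P p := by
  induction h with
  | base => exact hbase
  | @continuation U V W g h _ ho hc hs hd hWo hWn hW heq ih =>
    refine ih.continuation (W := σ ⁻¹' W) (ho.preimage σ.continuous)
      (σ.isPreconnected_preimage.2 hc) ((preimage_mono hs).trans hdom)
      ((hd.comp hσ.differentiableOn fun p hp => hp).add hP.differentiableOn)
      (hWo.preimage σ.continuous) (hWn.preimage σ.surjective) (preimage_mono hW) fun p hp => ?_
    simp only [heq hp]

/-- The translation `(z, τ) ↦ (z + τ, τ)`. -/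
def shift : ℂ × ℂ ≃ₜ ℂ × ℂ where
  toFun p := (p.1 + p.2, p.2)
  invFun p := (p.1 - p.2, p.2)
  left_inv p := by simp
  right_inv p := by simp
  continuous_toFun := by fun_prop
  continuous_invFun := by fun_prop

/-- The reflection `(z, τ) ↦ (τ - z, τ)`, which preserves the strip. -/
def flip : ℂ × ℂ ≃ₜ ℂ × ℂ where
  toFun p := (p.2 - p.1, p.2)
  invFun p := (p.2 - p.1, p.2)
  left_inv p := by simp
  right_inv p := by simp
  continuous_toFun := by fun_prop
  continuous_invFun := by fun_prop

lemma shift_apply (p : ℂ × ℂ) : shift p = (p.1 + p.2, p.2) := rfl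

lemma flip_apply (p : ℂ × ℂ) : flip p = (p.2 - p.1, p.2) := rfl

lemma differentiable_shift : Differentiable ℂ shift := by
  change Differentiable ℂ fun p : ℂ × ℂ => (p.1 + p.2, p.2)
  fun_prop

lemma differentiable_flip : Differentiable ℂ flip := by
  change Differentiable ℂ fun p : ℂ × ℂ => (p.2 - p.1, p.2)
  fun_prop

lemma shift_preimage_domain : shift ⁻¹' domain ⊆ domain := fun p hp =>
  ⟨hp.1, fun m n h => hp.2 m (n + 1) (by
    simp only [shift_apply]; push_cast; linear_combination h)⟩

lemma flip_preimage_domain : flip ⁻¹' domain ⊆ domain := fun p hp =>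
  ⟨hp.1, fun m n h => hp.2 (-m) (1 - n) (by
    simp only [flip_apply]; push_cast; linear_combination -h)⟩

lemma convex_strip : Convex ℝ strip := by
  have h1 : IsLinearMap ℝ fun p : ℂ × ℂ => p.1.im := ⟨by intros; simp, by intros; simp⟩
  have h2 : IsLinearMap ℝ fun p : ℂ × ℂ => p.1.im - p.2.im :=
    ⟨by intros; simp; ring, by intros; simp; ring⟩
  convert! (convex_halfSpace_gt h1 0).inter (convex_halfSpace_lt h2 0) using 1
  ext p
  simp [strip]

/-- Splitting off the first term of the series shifts the argument by `τ`. -/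
lemma polyLambert_eq_lam_add (r : ℕ) {x τ : ℂ} (hx : 0 < (x + τ).im) (hτ : 0 < τ.im) :
    polyLambert r 0 x τ = lam r (x + τ) + polyLambert r 0 (x + τ) τ := by
  have hs := (summable_norm_polyLambert r 0 hx hτ).of_norm
  rw [polyLambert, hs.tsum_eq_zero_add, polyLambert]
  congr 1
  · simp
  · refine tsum_congr fun n => ?_
    push_cast
    rw [pow_zero, pow_zero]
    congr 2
    ring

lemma differentiable_chi_three {f g : ℂ × ℂ → ℂ} (hf : Differentiable ℂ f)
    (hg : Differentiable ℂ g) : Differentiable ℂ fun p => chi 3 (f p) (g p) := by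
  simp only [chi_three]
  fun_prop

/-- On the strip, `f(τ - z, τ)` and `f(z, τ)` differ by a polynomial: the two series of
polylogarithms are interchanged. -/
lemma isBranch_flip : ∃ P : ℂ × ℂ → ℂ, Differentiable ℂ P ∧
    IsBranch (flip ⁻¹' strip) fun p => trilog (flip p) + P p := by
  have hP : Differentiable ℂ fun p : ℂ × ℂ => 1 / (2 * Real.pi * I) ^ 3 *
      (chi 3 (2 * Real.pi * I * (p.2 - p.1)) (2 * Real.pi * I * p.2) -
        chi 3 (2 * Real.pi * I * p.1) (2 * Real.pi * I * p.2)) :=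
    ((differentiable_chi_three (by fun_prop) (by fun_prop)).sub
      (differentiable_chi_three (by fun_prop) (by fun_prop))).const_mul _
  have hs : flip ⁻¹' strip = strip := by
    ext p
    simp only [mem_preimage, flip_apply, strip, mem_ofPred_eq, sub_im]
    constructor <;> rintro ⟨h1, h2⟩ <;> constructor <;> linarith
  refine ⟨_, hP, ?_⟩
  refine IsBranch.base.continuation (W := strip) (isOpen_strip.preimage flip.continuous)
    (flip.isPreconnected_preimage.2 convex_strip.isPreconnected) (hs.subset.trans strip_subset_domain)
    ((differentiableOn_trilog.comp differentiable_flip.differentiableOn fun p hp => hp).add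
      hP.differentiableOn) isOpen_strip ?_ (by rw [hs, inter_self]) fun p hp => ?_
  · exact ⟨(I / 2, I), by norm_num [strip]⟩
  · obtain ⟨h1, h2, h3, h4⟩ := im_pos_of_mem_strip hp
    have e1 := polyLambert_eq_lam_add 3 h4 h2
    have e2 := polyLambert_eq_lam_add 3 (x := p.1 - p.2) (by simpa using h1) h2
    rw [sub_add_cancel] at e2
    have e3 := trilog_eq (p := (p.2 - p.1, p.2)) (by
      simp only [add_im, sub_im, neg_im] at *; linarith) h2
    rw [flip_apply, e3, trilog_eq h3 h2, regularPart, regularPart]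
    simp only [neg_sub]
    rw [e1, e2, neg_add_eq_sub]
    ring

/-- One step of the construction of a local primitive across the real axis: `G` is a primitive of
`F` that continues `lu` from above, and below the axis differs from `lo` by an entire function. -/
lemma exists_primitive_across_real {F lu lo c : ℂ → ℂ} {x r : ℝ} (hr : 0 < r)
    (hF : DifferentiableOn ℂ F (ball (x : ℂ) r)) (hc : Differentiable ℂ c)
    (hlu : ∀ z ∈ ball (x : ℂ) r, 0 < z.im → HasDerivAt lu (F z) z)
    (hlo : ∀ z ∈ ball (x : ℂ) r, z.im < 0 → HasDerivAt lo (F z - c z) z) :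
    ∃ G d : ℂ → ℂ, (∀ z ∈ ball (x : ℂ) r, HasDerivAt G (F z) z) ∧ Differentiable ℂ d ∧
      (∀ z ∈ ball (x : ℂ) r, 0 < z.im → G z = lu z) ∧
      ∀ z ∈ ball (x : ℂ) r, z.im < 0 → G z = lo z + d z := by
  set a : ℂ := x + (r / 2 : ℝ) * I with ha
  set a' : ℂ := x + (-(r / 2) : ℝ) * I with ha'
  have hab : a ∈ ball (x : ℂ) r := by
    rw [mem_ball, dist_eq_norm, ha, add_sub_cancel_left, norm_mul, norm_I, mul_one, norm_real,
      Real.norm_of_nonneg (by positivity)]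
    linarith
  have hab' : a' ∈ ball (x : ℂ) r := by
    rw [mem_ball, dist_eq_norm, ha', add_sub_cancel_left, norm_mul, norm_I, mul_one, norm_real,
      norm_neg, Real.norm_of_nonneg (by positivity)]
    linarith
  have hai : 0 < a.im := by simp [ha, hr]
  have hai' : a'.im < 0 := by simp [ha', hr]
  obtain ⟨G, hGa, hG⟩ := hF.isExactOn_ball.with_val_at a (lu a)
  obtain ⟨d, hda, hd⟩ := hc.isExactOn_univ.with_val_at a' (G a' - lo a')
  refine ⟨G, d, hG, fun z => (hd z (mem_univ z)).differentiableAt, ?_, ?_⟩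
  · have hop : IsOpen (ball (x : ℂ) r ∩ {z : ℂ | 0 < z.im}) :=
      isOpen_ball.inter (isOpen_lt continuous_const continuous_im)
    have hcv : IsPreconnected (ball (x : ℂ) r ∩ {z : ℂ | 0 < z.im}) :=
      ((convex_ball _ _).inter (convex_halfSpace_im_gt 0)).isPreconnected
    intro z hz hzi
    refine hop.eqOn_of_deriv_eq hcv
      (fun y hy => (hG y hy.1).differentiableAt.differentiableWithinAt)
      (fun y hy => (hlu y hy.1 hy.2).differentiableAt.differentiableWithinAt)
      (fun y hy => by rw [(hG y hy.1).deriv, (hlu y hy.1 hy.2).deriv])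
      (x := a) ⟨hab, hai⟩ hGa ⟨hz, hzi⟩
  · have hop : IsOpen (ball (x : ℂ) r ∩ {z : ℂ | z.im < 0}) :=
      isOpen_ball.inter (isOpen_lt continuous_im continuous_const)
    have hcv : IsPreconnected (ball (x : ℂ) r ∩ {z : ℂ | z.im < 0}) :=
      ((convex_ball _ _).inter (convex_halfSpace_im_lt 0)).isPreconnected
    have hs : ∀ y ∈ ball (x : ℂ) r, y.im < 0 → HasDerivAt (fun y => lo y + d y) (F y) y :=
      fun y hy hyi => by simpa using! (hlo y hy hyi).add (hd y (mem_univ y))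
    intro z hz hzi
    refine hop.eqOn_of_deriv_eq hcv (g := fun y => lo y + d y)
      (fun y hy => (hG y hy.1).differentiableAt.differentiableWithinAt)
      (fun y hy => (hs y hy.1 hy.2).differentiableAt.differentiableWithinAt)
      (fun y hy => by rw [(hG y hy.1).deriv, (hs y hy.1 hy.2).deriv])
      (x := a') ⟨hab', hai'⟩ (by rw [hda]; ring) ⟨hz, hzi⟩

lemma hasDerivAt_lam_neg (r : ℕ) {x : ℂ} (hx : x.im < 0) :
    HasDerivAt (fun x => lam (r + 1) (-x)) (-(2 * Real.pi * I * lam r (-x))) x := by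
  have hx' : 0 < (-x).im := by simpa using hx
  simpa [Function.comp_def] using (hasDerivAt_lam r hx').comp x (hasDerivAt_neg x)

/-- The trilogarithm `Li₃(e^{2πiz})` extends from the upper half plane across the real axis near a
point that is not an integer, and there is an inversion formula on the other side. -/
lemma exists_continuation_lam_three {x r : ℝ} (hr : 0 < r)
    (hx : ∀ n : ℤ, (n : ℂ) ∉ ball (x : ℂ) r) :
    ∃ L d : ℂ → ℂ, DifferentiableOn ℂ L (ball (x : ℂ) r) ∧ Differentiable ℂ d ∧
      (∀ z ∈ ball (x : ℂ) r, 0 < z.im → L z = lam 3 z) ∧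
      ∀ z ∈ ball (x : ℂ) r, z.im < 0 → L z = lam 3 (-z) + d z := by
  set c : ℂ := 2 * Real.pi * I with hc
  have hne : ∀ z ∈ ball (x : ℂ) r, cexp2 z ≠ 1 := fun z hz h => by
    obtain ⟨n, rfl⟩ := cexp2_eq_one_iff.1 h
    exact hx n hz
  have diff : ∀ {G F : ℂ → ℂ}, (∀ z ∈ ball (x : ℂ) r, HasDerivAt G (F z) z) →
      DifferentiableOn ℂ G (ball (x : ℂ) r) := fun h z hz =>
    (h z hz).differentiableAt.differentiableWithinAt
  -- In order one, `ζ / (1 - ζ) + ζ⁻¹ / (1 - ζ⁻¹) = -1` gives the entire function below the axis.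
  obtain ⟨L₁, d₁, h1, h1d, h1u, h1l⟩ := exists_primitive_across_real (F := fun z => c * geom z)
    (lu := lam 1) (lo := fun z => lam 1 (-z)) (c := fun _ => -c) hr
    (fun z hz => ((differentiableAt_geom (hne z hz)).const_mul c).differentiableWithinAt)
    (by fun_prop)
    (fun z hz hzi => by rw [← lam_zero hzi]; exact hasDerivAt_lam 0 hzi)
    (fun z hz hzi => by
      have h := hasDerivAt_lam_neg 0 hzi
      have h2 := inv_one_sub_cexp2_eq_neg_geom z
      rw [inv_one_sub_cexp2_eq_geom_add_one (hne z hz)] at h2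
      rw [lam_zero (show 0 < (-z).im by simpa using hzi), ← hc] at h
      convert h using 1
      linear_combination c * h2)
  obtain ⟨L₂, d₂, h2, h2d, h2u, h2l⟩ := exists_primitive_across_real (F := fun z => c * L₁ z)
    (lu := lam 2) (lo := fun z => -lam 2 (-z)) (c := fun z => c * d₁ z) hr
    ((diff h1).const_mul c) (h1d.const_mul c)
    (fun z hz hzi => by simp only [h1u z hz hzi]; exact hasDerivAt_lam 1 hzi)
    (fun z hz hzi => by
      have h := (hasDerivAt_lam_neg 1 hzi).neg
      convert! h using 1
      rw [h1l z hz hzi, ← hc]; ring)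
  obtain ⟨L₃, d₃, h3, h3d, h3u, h3l⟩ := exists_primitive_across_real (F := fun z => c * L₂ z)
    (lu := lam 3) (lo := fun z => lam 3 (-z)) (c := fun z => c * d₂ z) hr
    ((diff h2).const_mul c) (h2d.const_mul c)
    (fun z hz hzi => by simp only [h2u z hz hzi]; exact hasDerivAt_lam 2 hzi)
    (fun z hz hzi => by
      have h := hasDerivAt_lam_neg 2 hzi
      convert! h using 1
      rw [h2l z hz hzi, ← hc]; ring)
  exact ⟨L₃, d₃, diff h3, h3d, h3u, h3l⟩

/-- The points `(z, τ)` with `z` in a disc around the real number `x` and `|Im z| < Im τ`. -/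
def bridge (x r : ℝ) : Set (ℂ × ℂ) :=
  {p | p.1 ∈ ball (x : ℂ) r ∧ -p.2.im < p.1.im ∧ p.1.im < p.2.im}

lemma isOpen_bridge (x r : ℝ) : IsOpen (bridge x r) := by
  simp only [bridge, ofPred_and]
  exact (isOpen_ball.preimage continuous_fst).inter
    ((isOpen_lt (by fun_prop) (by fun_prop)).inter (isOpen_lt (by fun_prop) (by fun_prop)))

lemma convex_bridge (x r : ℝ) : Convex ℝ (bridge x r) := by
  have h1 : IsLinearMap ℝ fun p : ℂ × ℂ => p.1.im + p.2.im :=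
    ⟨by intros; simp; ring, by intros; simp; ring⟩
  have h2 : IsLinearMap ℝ fun p : ℂ × ℂ => p.1.im - p.2.im :=
    ⟨by intros; simp; ring, by intros; simp; ring⟩
  convert! ((convex_ball (x : ℂ) r).linear_preimage (LinearMap.fst ℝ ℂ ℂ)).inter
    ((convex_halfSpace_gt h1 0).inter (convex_halfSpace_lt h2 0)) using 1
  ext p
  simp [bridge, neg_lt_iff_pos_add]

lemma bridge_subset_domain {x r : ℝ} (hx : ∀ n : ℤ, (n : ℂ) ∉ ball (x : ℂ) r) :
    bridge x r ⊆ domain := by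
  rintro p ⟨hb, h1, h2⟩
  have hτ : 0 < p.2.im := by linarith
  refine ⟨hτ, fun m n h => ?_⟩
  have him : p.1.im = n * p.2.im := by rw [h]; simp
  rw [him] at h1 h2
  have n0 : (-1 : ℝ) < n := by nlinarith
  have n1 : (n : ℝ) < 1 := by nlinarith
  norm_cast at n0 n1
  obtain rfl : n = 0 := by omega
  exact hx m (by simpa [h] using hb)

/-- The function element `f` on the strip continues to a neighbourhood of the real segment, and
coincides below the real axis with `f(z + τ, τ)` up to an entire function. -/
lemma exists_isBranch_bridge {x r : ℝ} (hr : 0 < r) (hx : ∀ n : ℤ, (n : ℂ) ∉ ball (x : ℂ) r) :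
    ∃ h P : ℂ × ℂ → ℂ, IsBranch (bridge x r) h ∧ Differentiable ℂ P ∧
      EqOn h (fun p => trilog (shift p) + P p) (bridge x r ∩ shift ⁻¹' strip) := by
  obtain ⟨L, d, hL, hd, hu, hl⟩ := exists_continuation_lam_three hr hx
  have hP : Differentiable ℂ fun p : ℂ × ℂ => 1 / (2 * Real.pi * I) ^ 3 *
      (d p.1 + (chi 3 (2 * Real.pi * I * (p.1 + p.2)) (2 * Real.pi * I * p.2) -
        chi 3 (2 * Real.pi * I * p.1) (2 * Real.pi * I * p.2))) :=
    ((hd.comp differentiable_fst).add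
      ((differentiable_chi_three (by fun_prop) (by fun_prop)).sub
      (differentiable_chi_three (by fun_prop) (by fun_prop)))).const_mul _
  refine ⟨fun p => 1 / (2 * Real.pi * I) ^ 3 * (L p.1 + regularPart p), _, ?_, hP, ?_⟩
  · refine IsBranch.base.continuation (W := strip ∩ bridge x r) (isOpen_bridge x r)
      (convex_bridge x r).isPreconnected (bridge_subset_domain hx) ?_
      (isOpen_strip.inter (isOpen_bridge x r)) ?_ subset_rfl ?_
    · rintro p ⟨hb, h1, h2⟩
      have dL : DifferentiableAt ℂ (fun p : ℂ × ℂ => L p.1) p :=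
        DifferentiableAt.comp p (hL.differentiableAt (isOpen_ball.mem_nhds hb))
          differentiableAt_fst
      have dR : DifferentiableAt ℂ regularPart p := by
        refine differentiableAt_regularPart ?_ ?_ (by linarith) <;> simp only [add_im, neg_im] <;>
          linarith
      exact ((dL.add dR).const_mul _).differentiableWithinAt
    · have hm : 0 < min r 1 := by positivity
      have hm1 := min_le_left r 1
      have hm2 := min_le_right r 1
      refine ⟨(x + (min r 1 / 2 : ℝ) * I, I), ?_, ?_, ?_⟩
      · simp only [strip, mem_ofPred_eq, add_im, ofReal_im, mul_im, ofReal_re, I_im, I_re]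
        constructor <;> linarith
      · rw [mem_ball, dist_eq_norm, add_sub_cancel_left, norm_mul, norm_I, mul_one, norm_real,
          Real.norm_of_nonneg (by positivity)]
        linarith
      · simp only [add_im, ofReal_im, mul_im, ofReal_re, I_im, I_re]
        constructor <;> linarith
    · rintro p ⟨hs, hb⟩
      obtain ⟨h1, h2, h3, h4⟩ := im_pos_of_mem_strip hs
      simp only [trilog_eq h3 h2, hu p.1 hb.1 h1]
  · rintro p ⟨⟨hb, h1, h2⟩, hs⟩
    have hz : p.1.im < 0 := by simpa [shift_apply] using hs.2
    have hτ : 0 < p.2.im := by linarith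
    have h3 : 0 < (p.1 + p.2).im := by simp only [add_im]; linarith
    have e1 := polyLambert_eq_lam_add 3 h3 hτ
    have e2 := polyLambert_eq_lam_add 3 (x := -(p.1 + p.2)) (τ := p.2) (by simpa using hz) hτ
    rw [show -(p.1 + p.2) + p.2 = -p.1 by ring] at e2
    have e3 := trilog_eq (p := (p.1 + p.2, p.2)) (by
      simp only [add_im] at *; linarith) hτ
    simp only [shift_apply]
    rw [e3, regularPart, regularPart, hl p.1 hb hz]
    rw [e1, e2]
    ring

/-- The function `f(z + τ, τ)`, on the strip below the real axis, is a branch of `f` up to an entire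
function: the two strips are joined by a bridge near `z = 1/2`. -/
lemma isBranch_shift : ∃ P : ℂ × ℂ → ℂ, Differentiable ℂ P ∧
    IsBranch (shift ⁻¹' strip) fun p => trilog (shift p) + P p := by
  have hx : ∀ n : ℤ, (n : ℂ) ∉ ball ((1 / 2 : ℝ) : ℂ) (1 / 2) := fun n hn => by
    rw [mem_ball, dist_eq_norm, ← ofReal_intCast, ← ofReal_sub, norm_real, Real.norm_eq_abs,
      abs_lt] at hn
    have h1 : (0 : ℝ) < n := by linarith
    have h2 : (n : ℝ) < 1 := by linarith
    norm_cast at h1 h2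
    omega
  obtain ⟨h, P, hb, hP, heq⟩ := exists_isBranch_bridge (by norm_num) hx
  refine ⟨P, hP, hb.continuation (isOpen_strip.preimage shift.continuous)
    (shift.isPreconnected_preimage.2 convex_strip.isPreconnected)
    ((preimage_mono strip_subset_domain).trans shift_preimage_domain)
    ((differentiableOn_trilog.comp differentiable_shift.differentiableOn fun p hp => hp).add
      hP.differentiableOn)
    ((isOpen_bridge _ _).inter (isOpen_strip.preimage shift.continuous)) ?_ subset_rfl heq⟩
  refine ⟨(((1 / 2 : ℝ) : ℂ) + (-(1 / 4) : ℝ) * I, I), ⟨?_, ?_⟩, ?_⟩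
  · rw [mem_ball, dist_eq_norm, add_sub_cancel_left, norm_mul, norm_I, mul_one, norm_real]
    norm_num
  · norm_num
  · norm_num [shift_apply, strip]

lemma exists_isBranchAt_of_shift {p : ℂ × ℂ} (h : ∃ g, IsBranchAt g (shift p)) :
    ∃ g, IsBranchAt g p := by
  obtain ⟨g, U, hU, hp⟩ := h
  obtain ⟨P, hP, hb⟩ := isBranch_shift
  exact ⟨_, _, IsBranch.transport differentiable_shift shift_preimage_domain hP hb hU, hp⟩

lemma exists_isBranchAt_of_flip {p : ℂ × ℂ} (h : ∃ g, IsBranchAt g (flip p)) :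
    ∃ g, IsBranchAt g p := by
  obtain ⟨g, U, hU, hp⟩ := h
  obtain ⟨P, hP, hb⟩ := isBranch_flip
  exact ⟨_, _, IsBranch.transport differentiable_flip flip_preimage_domain hP hb hU, hp⟩

/-- Continuability to a point depends only on its class modulo `τ`. -/
lemma exists_isBranchAt_of_add_int_mul (τ : ℂ) (n : ℤ) : ∀ z : ℂ,
    (∃ g, IsBranchAt g (z + n * τ, τ)) → ∃ g, IsBranchAt g (z, τ) := by
  have hneg : ∀ z : ℂ, (∃ g, IsBranchAt g (z - τ, τ)) → ∃ g, IsBranchAt g (z, τ) := fun z h => by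
    -- The inverse translation is the conjugate of the translation by the reflection.
    refine exists_isBranchAt_of_flip (exists_isBranchAt_of_shift (exists_isBranchAt_of_flip ?_))
    convert! h using 3
    simp only [flip_apply, shift_apply]
    ring_nf
  induction n using Int.induction_on with
  | zero => intro z h; simpa using h
  | succ k ih =>
    intro z h
    refine ih z (exists_isBranchAt_of_shift ?_)
    convert! h using 3
    simp only [shift_apply]
    push_cast
    ring_nf
  | pred k ih =>
    intro z h
    refine ih z (hneg _ ?_)
    convert! h using 3
    push_cast
    ring_nf

/-- The function `f` continues analytically to a neighbourhood of every point of its domain. -/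
theorem exists_isBranchAt {p : ℂ × ℂ} (hp : p ∈ domain) : ∃ g, IsBranchAt g p := by
  obtain ⟨z, τ⟩ := p
  have hτ : 0 < τ.im := hp.1
  set n : ℤ := ⌊z.im / τ.im⌋ with hn
  have h1 : n * τ.im ≤ z.im := (le_div_iff₀ hτ).1 (Int.floor_le _)
  have h2 : z.im < (n + 1) * τ.im := (div_lt_iff₀ hτ).1 (Int.lt_floor_add_one _)
  refine exists_isBranchAt_of_add_int_mul τ (-n) z ?_
  have him : (z + (-n : ℤ) * τ).im = z.im - n * τ.im := by simp; ring
  set y := z + (-n : ℤ) * τ with hy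
  have h0 : 0 ≤ y.im := by linarith
  have h3 : y.im < τ.im := by linarith
  rcases h0.lt_or_eq with h0 | h0
  · exact ⟨trilog, strip, .base, h0, h3⟩
  · -- On the real axis the disc reaches to the nearest integer.
    have hyr : y = (y.re : ℂ) := by apply Complex.ext <;> simp [← h0]
    set r : ℝ := |y.re - round y.re| with hr
    have hr0 : 0 < r := by
      rw [hr, abs_pos, sub_ne_zero]
      intro h
      refine hp.2 (round y.re) n ?_
      have : y = (round y.re : ℂ) := by rw [hyr]; simp only [ofReal_re]; exact_mod_cast h
      simp only
      rw [← this, hy]; push_cast; ring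
    have hx : ∀ m : ℤ, (m : ℂ) ∉ ball (y.re : ℂ) r := fun m hm => by
      rw [mem_ball, dist_comm, dist_eq_norm, ← ofReal_intCast, ← ofReal_sub, norm_real,
        Real.norm_eq_abs] at hm
      exact absurd (round_le y.re m) (not_le.2 hm)
    obtain ⟨h, -, hb, -⟩ := exists_isBranch_bridge hr0 hx
    refine ⟨h, _, hb, ?_, ?_, h3⟩
    · simp only
      rw [← hyr]; exact mem_ball_self hr0
    · simp only; linarith

/-! ### Positive roots of the root systems of rank two -/

section Roots

lemma cpair_add_smul (z : Fin 2 → ℂ) (v w : EuclideanSpace ℝ (Fin 2)) (m n : ℕ) :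
    cpair z ((m : ℤ) • v + (n : ℤ) • w) = m * cpair z v + n * cpair z w := by
  simp only [cpair, Fin.sum_univ_two, PiLp.add_apply, PiLp.smul_apply, zsmul_eq_mul]
  push_cast
  ring

variable {ι N : Type*} [AddCommGroup N] [Module ℝ N]
  {P : RootPairing ι ℝ (EuclideanSpace ℝ (Fin 2)) N}

/-- If the reflections are orthogonal, then the pairing of roots is the one of Euclidean
geometry. -/
lemma pairing_mul_inner_self (hP : ∀ (i : ι) (v w : EuclideanSpace ℝ (Fin 2)),
      inner ℝ (P.reflection i v) (P.reflection i w) = inner ℝ v w) (i j : ι) :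
    P.pairing i j * inner ℝ (P.root j) (P.root j) = 2 * inner ℝ (P.root i) (P.root j) := by
  have h := hP j (P.root i) (P.root j)
  rw [P.reflection_apply_self, P.reflection_apply_root, inner_neg_right, inner_sub_left,
    real_inner_smul_left] at h
  linarith

lemma root_reflectionPerm_eq (i j : ι) :
    P.root (P.reflectionPerm j i) = P.root i - P.pairing i j • P.root j := by
  rw [P.root_reflectionPerm, P.reflection_apply_root]

/-- The effect of a simple reflection on the coordinates with respect to two simple roots, where
`p = 2 (α, β) / (α, α)` is a Cartan integer. -/
lemma root_reflectionPerm_of_coords (hP : ∀ (i : ι) (v w : EuclideanSpace ℝ (Fin 2)),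
      inner ℝ (P.reflection i v) (P.reflection i w) = inner ℝ v w) {α β i : ι} {p m n : ℤ}
    (h0 : inner ℝ (P.root α) (P.root α) ≠ (0 : ℝ))
    (hp : 2 * inner ℝ (P.root α) (P.root β) = p * inner ℝ (P.root α) (P.root α))
    (hi : P.root i = m • P.root α + n • P.root β) :
    P.root (P.reflectionPerm α i) = (-m - n * p) • P.root α + n • P.root β := by
  have h := pairing_mul_inner_self hP i α
  have hpair : P.pairing i α = ((2 * m + n * p : ℤ) : ℝ) := by
    refine mul_right_cancel₀ h0 ?_
    rw [h, hi, ← Int.cast_smul_eq_zsmul ℝ, ← Int.cast_smul_eq_zsmul ℝ, inner_add_left,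
      real_inner_smul_left, real_inner_smul_left, real_inner_comm (P.root α) (P.root β)]
    push_cast
    linear_combination (n : ℝ) * hp
  rw [root_reflectionPerm_eq, hpair, Int.cast_smul_eq_zsmul, hi]
  module

variable (b : P.Base)

lemma height_of_coords {α β i : ι} (hb : (b.support : Set ι) = {α, β}) (hne : α ≠ β) {m n : ℤ}
    (hi : P.root i = m • P.root α + n • P.root β) : b.height i = m + n := by
  classical
  have hs : b.support = {α, β} := by
    ext x
    have := Set.ext_iff.1 hb x
    simpa using this
  have := b.height_eq_sum (f := fun j => if j = α then m else n) (i := i) (by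
    rw [hs, Finset.sum_pair hne, hi]; simp [hne.symm])
  rw [this, hs, Finset.sum_pair hne]
  simp [hne.symm]

variable [Fintype ι] [P.IsCrystallographic] [P.IsReduced]

/-- The positive roots of a root system of rank two with simple roots `α`, `β` and Cartan integers
`p = 2 (α, β) / (α, α)`, `q = 2 (α, β) / (β, β)` are those with the coordinates `(c k, d k)`, if
this list is closed up to sign under the simple reflections (`hsα`, `hsβ`) and each of its members
is a simple root or the image of an earlier one under a simple reflection (`hgen`). -/
theorem exists_enumeration_isPos (hP : ∀ (i : ι) (v w : EuclideanSpace ℝ (Fin 2)),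
      inner ℝ (P.reflection i v) (P.reflection i w) = inner ℝ v w)
    {α β : ι} (hb : (b.support : Set ι) = {α, β}) (hne : α ≠ β) {p q : ℤ}
    (hα : inner ℝ (P.root α) (P.root α) ≠ (0 : ℝ)) (hβ : inner ℝ (P.root β) (P.root β) ≠ (0 : ℝ))
    (hp : 2 * inner ℝ (P.root α) (P.root β) = p * inner ℝ (P.root α) (P.root α))
    (hq : 2 * inner ℝ (P.root α) (P.root β) = q * inner ℝ (P.root β) (P.root β))
    {N : ℕ} (c d : Fin N → ℕ) (hpos : ∀ k, 0 < c k + d k)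
    (hinj : ∀ k l, c k = c l → d k = d l → k = l)
    (h10 : ∃ k, c k = 1 ∧ d k = 0) (h01 : ∃ k, c k = 0 ∧ d k = 1)
    (hsα : ∀ k, ∃ l, ∃ s ∈ ({1, -1} : Finset ℤ),
      -(c k : ℤ) - d k * p = s * c l ∧ (d k : ℤ) = s * d l)
    (hsβ : ∀ k, ∃ l, ∃ s ∈ ({1, -1} : Finset ℤ),
      (c k : ℤ) = s * c l ∧ -(d k : ℤ) - c k * q = s * d l)
    (hgen : ∀ k, (c k = 1 ∧ d k = 0) ∨ (c k = 0 ∧ d k = 1) ∨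
      ∃ l < k, (-(c l : ℤ) - d l * p = c k ∧ d l = d k) ∨
        (c l = c k ∧ -(d l : ℤ) - c l * q = d k)) :
    ∃ e : Fin N ↪ ι, (∀ i, b.IsPos i ↔ ∃ k, e k = i) ∧
      ∀ k, P.root (e k) = (c k : ℤ) • P.root α + (d k : ℤ) • P.root β := by
  have hq' : 2 * inner ℝ (P.root β) (P.root α) = q * inner ℝ (P.root β) (P.root β) := by
    rw [real_inner_comm]; exact hq
  have hex : ∀ k, ∃ i, P.root i = (c k : ℤ) • P.root α + (d k : ℤ) • P.root β := by
    intro k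
    induction k using WellFoundedLT.induction with
    | ind k ih =>
      rcases hgen k with ⟨h1, h2⟩ | ⟨h1, h2⟩ | ⟨l, hl, ⟨h1, h2⟩ | ⟨h1, h2⟩⟩
      · exact ⟨α, by simp [h1, h2]⟩
      · exact ⟨β, by simp [h1, h2]⟩
      · obtain ⟨i, hi⟩ := ih l hl
        exact ⟨_, by rw [root_reflectionPerm_of_coords hP hα hp hi, h1, h2]⟩
      · obtain ⟨i, hi⟩ := ih l hl
        exact ⟨_, by rw [root_reflectionPerm_of_coords hP hβ hq' (hi.trans (add_comm _ _)), h2,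
          h1, add_comm]⟩
  choose e he using hex
  have hαs : α ∈ b.support := by
    have : α ∈ (b.support : Set ι) := by rw [hb]; simp
    exact this
  have hβs : β ∈ b.support := by
    have : β ∈ (b.support : Set ι) := by rw [hb]; simp
    exact this
  have hli : LinearIndependent ℝ ![P.root α, P.root β] :=
    b.linearIndependent_pair_of_ne (i := ⟨α, hαs⟩) (j := ⟨β, hβs⟩) fun h =>
      hne (congrArg Subtype.val h)
  have einj : Function.Injective e := fun k l hkl => by
    have h := (he k).symm.trans ((congrArg P.root hkl).trans (he l))
    have h' : ((c k : ℝ) - c l) • P.root α + ((d k : ℝ) - d l) • P.root β = 0 := by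
      simp only [← Int.cast_smul_eq_zsmul ℝ, Int.cast_natCast] at h
      rw [sub_smul, sub_smul, ← sub_eq_zero.2 h]
      module
    obtain ⟨h1, h2⟩ := LinearIndependent.pair_iff.1 hli _ _ h'
    exact hinj k l (by exact_mod_cast sub_eq_zero.1 h1) (by exact_mod_cast sub_eq_zero.1 h2)
  refine ⟨⟨e, einj⟩, fun i => ⟨fun hi => ?_, ?_⟩, he⟩
  · -- Every root is, up to sign, one of the list.
    have hall : ∃ k, ∃ s ∈ ({1, -1} : Finset ℤ),
        P.root i = (s * c k) • P.root α + (s * d k) • P.root β := by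
      refine hi.induction_on_reflect (p := fun i => ∃ k, ∃ s ∈ ({1, -1} : Finset ℤ),
        P.root i = (s * c k) • P.root α + (s * d k) • P.root β) (fun j hj => ?_)
        fun i j hi hj => ?_
      · have hj' : j ∈ (b.support : Set ι) := hj
        rw [hb] at hj'
        rcases hj' with rfl | rfl
        · obtain ⟨k, h1, h2⟩ := h10
          exact ⟨k, 1, by simp, by simp [h1, h2]⟩
        · obtain ⟨k, h1, h2⟩ := h01
          exact ⟨k, 1, by simp, by simp [h1, h2]⟩
      · have hj' : j ∈ (b.support : Set ι) := hj
        rw [hb] at hj'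
        obtain ⟨k, s, hs, hi⟩ := hi
        have hmul : ∀ t ∈ ({1, -1} : Finset ℤ), s * t ∈ ({1, -1} : Finset ℤ) := fun t ht => by
          simp only [Finset.mem_insert, Finset.mem_singleton] at hs ht ⊢
          rcases hs with rfl | rfl <;> rcases ht with rfl | rfl <;> simp
        rcases hj' with rfl | rfl
        · obtain ⟨l, t, ht, e1, e2⟩ := hsα k
          refine ⟨l, s * t, hmul t ht, ?_⟩
          rw [root_reflectionPerm_of_coords hP hα hp hi,
            show -(s * c k) - s * d k * p = s * t * c l by linear_combination s * e1,
            show s * (d k : ℤ) = s * t * d l by linear_combination s * e2]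
        · obtain ⟨l, t, ht, e1, e2⟩ := hsβ k
          refine ⟨l, s * t, hmul t ht, ?_⟩
          rw [root_reflectionPerm_of_coords hP hβ hq'
            (hi.trans (add_comm _ _)), add_comm,
            show -(s * d k) - s * c k * q = s * t * d l by linear_combination s * e2,
            show s * (c k : ℤ) = s * t * c l by linear_combination s * e1]
    obtain ⟨k, s, hs, hroot⟩ := hall
    have hh := height_of_coords b hb hne hroot
    have hi' : 0 < b.height i := hi
    have hk := hpos k
    simp only [Finset.mem_insert, Finset.mem_singleton] at hs
    rcases hs with rfl | rfl
    · refine ⟨k, P.root.injective ?_⟩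
      rw [hroot, one_mul, one_mul]
      exact he k
    · omega
  · rintro ⟨k, rfl⟩
    have hh := height_of_coords b hb hne (he k)
    have hk := hpos k
    change 0 < b.height (e k)
    omega

/-- Reduction of the identity for a root system of rank two to an identity in the two variables
`x = (z, α)` and `y = (z, β)`, given the coordinates `c k`, `d k` of the positive roots. -/
theorem frobeniusStickelberger_of_coords (hP : ∀ (i : ι) (v w : EuclideanSpace ℝ (Fin 2)),
      inner ℝ (P.reflection i v) (P.reflection i w) = inner ℝ v w)
    {α β : ι} (hb : (b.support : Set ι) = {α, β}) {A B C : ℝ}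
    (hA : inner ℝ (P.root α) (P.root α) = A) (hB : inner ℝ (P.root β) (P.root β) = B)
    (hC : inner ℝ (P.root α) (P.root β) = C) (hA0 : A ≠ 0) (hB0 : B ≠ 0) (hCA : C ≠ A)
    {p q : ℤ} (hp : 2 * C = p * A) (hq : 2 * C = q * B)
    {N : ℕ} (c d : Fin N → ℕ) (hpos : ∀ k, 0 < c k + d k)
    (hinj : ∀ k l, c k = c l → d k = d l → k = l)
    (h10 : ∃ k, c k = 1 ∧ d k = 0) (h01 : ∃ k, c k = 0 ∧ d k = 1)
    (hsα : ∀ k, ∃ l, ∃ s ∈ ({1, -1} : Finset ℤ),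
      -(c k : ℤ) - d k * p = s * c l ∧ (d k : ℤ) = s * d l)
    (hsβ : ∀ k, ∃ l, ∃ s ∈ ({1, -1} : Finset ℤ),
      (c k : ℤ) = s * c l ∧ -(d k : ℤ) - c k * q = s * d l)
    (hgen : ∀ k, (c k = 1 ∧ d k = 0) ∨ (c k = 0 ∧ d k = 1) ∨
      ∃ l < k, (-(c l : ℤ) - d l * p = c k ∧ d l = d k) ∨
        (c l = c k ∧ -(d l : ℤ) - c l * q = d k))
    (κ : ℝ → ℂ)
    (key : ∀ x y τ : ℂ, 0 < τ.im → (∀ k, ∀ m n : ℤ, c k * x + d k * y ≠ m + n * τ) →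
      (1 / 2 : ℂ) * (∑ k, ∑ l, if l = k then 0 else
        ((c k * c l * A + (c k * d l + d k * c l) * C + d k * d l * B : ℝ) : ℂ) *
          thetaA (c k * x + d k * y, τ) * thetaA (c l * x + d l * y, τ)) +
        ∑ k, κ (c k * c k * A + (c k * d k + d k * c k) * C + d k * d k * B) *
          thetaB (c k * x + d k * y, τ) = 0) :
    FrobeniusStickelberger b κ := by
  have hne : α ≠ β := by rintro rfl; exact hCA (hC.symm.trans hA)
  obtain ⟨e, he, hroot⟩ := exists_enumeration_isPos b hP hb hne (by rwa [hA]) (by rwa [hB])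
    (by rwa [hA, hC]) (by rwa [hB, hC]) c d hpos hinj h10 h01 hsα hsβ hgen
  classical
  intro z τ hτ hz
  refine ⟨fun i hi => exists_isBranchAt ⟨hτ, hz i hi⟩, fun g hg => ?_⟩
  have hcp : ∀ k, cpair z (P.root (e k)) =
      c k * cpair z (P.root α) + d k * cpair z (P.root β) := fun k => by
    rw [hroot, cpair_add_smul]
  have hpos : ∀ k, b.IsPos (e k) := fun k => (he _).2 ⟨k, rfl⟩
  have hin : ∀ k l, inner ℝ (P.root (e k)) (P.root (e l)) =
      c k * c l * A + (c k * d l + d k * c l) * C + d k * d l * B := fun k l => by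
    rw [hroot, hroot, ← hA, ← hB, ← hC]
    simp only [← Int.cast_smul_eq_zsmul ℝ, inner_add_left, inner_add_right, real_inner_smul_left,
      real_inner_smul_right, real_inner_comm (P.root α) (P.root β), Int.cast_natCast]
    ring
  have hsum : ∀ F : ι → ℂ, ∑ i with b.IsPos i, F i = ∑ k, F (e k) := fun F => by
    rw [← Finset.sum_map]
    refine Finset.sum_congr ?_ fun _ _ => rfl
    ext i
    simp [he]
  have hsum2 : ∀ (k : Fin N) (F : ι → ℂ), ∑ j with b.IsPos j ∧ j ≠ e k, F j =
      ∑ l, if l = k then 0 else F (e l) := fun k F => by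
    rw [← Finset.filter_filter, Finset.sum_filter, hsum]
    refine Finset.sum_congr rfl fun l _ => ?_
    by_cases h : l = k <;> simp [h]
  have hd1 : ∀ k, partialDeriv 3 0 (g (e k)) (cpair z (P.root (e k)), τ) =
      thetaA (c k * cpair z (P.root α) + d k * cpair z (P.root β), τ) := fun k => by
    rw [(hg _ (hpos k)).partialDeriv_eq.1, hcp]
  have hd2 : ∀ k, partialDeriv 2 1 (g (e k)) (cpair z (P.root (e k)), τ) =
      thetaB (c k * cpair z (P.root α) + d k * cpair z (P.root β), τ) := fun k => by
    rw [(hg _ (hpos k)).partialDeriv_eq.2, hcp]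
  have := key (cpair z (P.root α)) (cpair z (P.root β)) τ hτ fun k m n => by
    rw [← hcp]; exact hz _ (hpos k) m n
  convert this using 2
  · congr 1
    rw [hsum]
    refine Finset.sum_congr rfl fun k _ => ?_
    rw [hsum2]
    refine Finset.sum_congr rfl fun l _ => ?_
    rw [hd1, hd1, hin]
  · rw [hsum]
    refine Finset.sum_congr rfl fun k _ => ?_
    rw [hd2, hin]

end Roots

end EllipticTrilog

end

theorem mainTheorem3 {ι N : Type*} [Fintype ι] [AddCommGroup N] [Module ℝ N]
    (P : RootPairing ι ℝ (EuclideanSpace ℝ (Fin 2)) N)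
    [P.IsRootSystem] [P.IsCrystallographic] [P.IsReduced]
    (hP : ∀ (i : ι) (v w : EuclideanSpace ℝ (Fin 2)),
      inner ℝ (P.reflection i v) (P.reflection i w) = inner ℝ v w)
    (b : P.Base) (α β : ι) (hb : (b.support : Set ι) = {α, β}) :
    -- type A₂
    (inner ℝ (P.root α) (P.root α) = (2 : ℝ) → inner ℝ (P.root β) (P.root β) = (2 : ℝ) →
      inner ℝ (P.root α) (P.root β) = (-1 : ℝ) →
      EllipticTrilog.FrobeniusStickelberger b (fun _ => 1)) ∧
    -- type B₂
    (inner ℝ (P.root α) (P.root α) = (2 : ℝ) → inner ℝ (P.root β) (P.root β) = (1 : ℝ) →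
      inner ℝ (P.root α) (P.root β) = (-1 : ℝ) →
      EllipticTrilog.FrobeniusStickelberger b (fun l => if l = 1 then 2 else 1)) ∧
    -- type G₂
    (inner ℝ (P.root α) (P.root α) = (6 : ℝ) → inner ℝ (P.root β) (P.root β) = (2 : ℝ) →
      inner ℝ (P.root α) (P.root β) = (-3 : ℝ) →
      EllipticTrilog.FrobeniusStickelberger b (fun l => if l = 2 then 10 else 6)) := by
  refine ⟨fun hA hB hC => ?_, fun hA hB hC => ?_, fun hA hB hC => ?_⟩
  · refine EllipticTrilog.frobeniusStickelberger_of_coords b hP hb hA hB hC (by norm_num)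
      (by norm_num) (by norm_num) (p := -1) (q := -1) (by norm_num) (by norm_num)
      ![1, 0, 1] ![0, 1, 1] (by decide) (by decide) (by decide) (by decide) (by decide)
      (by decide) (by decide) _ fun x y τ hτ hz => ?_
    simp only [Fin.forall_fin_succ, Fin.sum_univ_succ] at hz ⊢
    simp at hz ⊢
    obtain ⟨h1, h2, h3⟩ := hz
    norm_num
    linear_combination EllipticTrilog.thetaA_add hτ h1 h2 h3
  · -- The triples of roots `γ + δ = ε` are `(α, β, α + β)` and `(β, α + β, α + 2β)`.
    refine EllipticTrilog.frobeniusStickelberger_of_coords b hP hb hA hB hC (by norm_num)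
      (by norm_num) (by norm_num) (p := -1) (q := -2) (by norm_num) (by norm_num)
      ![1, 0, 1, 1] ![0, 1, 1, 2] (by decide) (by decide) (by decide) (by decide) (by decide)
      (by decide) (by decide) _ fun x y τ hτ hz => ?_
    simp only [Fin.forall_fin_succ, Fin.sum_univ_succ] at hz ⊢
    simp at hz ⊢
    obtain ⟨h1, h2, h3, h4⟩ := hz
    have e1 : y + (x + y) = x + 2 * y := by ring
    have t1 := EllipticTrilog.thetaA_add hτ h1 h2 h3
    have t2 := EllipticTrilog.thetaA_add hτ h2 h3 (e1 ▸ h4)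
    rw [e1] at t2
    norm_num
    linear_combination t1 + t2
  · -- The multiplicities `3, 4, 3, 3, 3` of the five triples of roots `γ + δ = ε` are the ones
    -- that give the inner products as coefficients; the weights `10` and `6` follow.
    refine EllipticTrilog.frobeniusStickelberger_of_coords b hP hb hA hB hC (by norm_num)
      (by norm_num) (by norm_num) (p := -1) (q := -3) (by norm_num) (by norm_num)
      ![1, 0, 1, 1, 1, 2] ![0, 1, 1, 2, 3, 3] (by decide) (by decide) (by decide) (by decide)
      (by decide) (by decide) (by decide) _ fun x y τ hτ hz => ?_
    simp only [Fin.forall_fin_succ, Fin.sum_univ_succ] at hz ⊢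
    simp at hz ⊢
    obtain ⟨h1, h2, h3, h4, h5, h6⟩ := hz
    have e1 : y + (x + y) = x + 2 * y := by ring
    have e2 : y + (x + 2 * y) = x + 3 * y := by ring
    have e3 : x + (x + 3 * y) = 2 * x + 3 * y := by ring
    have e4 : x + y + (x + 2 * y) = 2 * x + 3 * y := by ring
    have t1 := EllipticTrilog.thetaA_add hτ h1 h2 h3
    have t2 := EllipticTrilog.thetaA_add hτ h2 h3 (e1 ▸ h4)
    have t3 := EllipticTrilog.thetaA_add hτ h2 h4 (e2 ▸ h5)
    have t4 := EllipticTrilog.thetaA_add hτ h1 h5 (e3 ▸ h6)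
    have t5 := EllipticTrilog.thetaA_add hτ h3 h4 (e4 ▸ h6)
    rw [e1] at t2
    rw [e2] at t3
    rw [e3] at t4
    rw [e4] at t5
    norm_num
    linear_combination 3 * t1 + 4 * t2 + 3 * t3 + 3 * t4 + 3 * t5
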